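/- All Hilbert spaces are finite-dimensional and complex, states are density matrices (positive semidefinite with trace one), and a test is a matrix $\Lambda$ with $0\preceq\Lambda\preceq\mathbb I$. For $\varepsilon\ge 0$ and $\delta\in[0,1]$, a pair of states $(\rho,\sigma)$ on the same space is $(\varepsilon,\delta)$-DP if for every test $\Lambda$ $$\mathrm{Tr}[\Lambda\rho]\le e^{\varepsilon}\,\mathrm{Tr}[\Lambda\sigma]+\delta\quad\text{and}\quad \mathrm{Tr}[\Lambda\sigma]\le e^{\varepsilon}\,\mathrm{Tr}[\Lambda\rho]+\delta .$$ On the four-dimensional space with orthonormal basis $|00\rangle,|01\rangle,|10\rangle,|11\rangle$ let $$\rho_{(\varepsilon,\delta)}=\delta\,|00\rangle\langle 00|+(1-\delta)\Big(\tfrac{e^\varepsilon}{1+e^\varepsilon}|01\rangle\langle 01|+\tfrac{1}{1+e^\varepsilon}|10\rangle\langle 10|\Big),$$ $$\sigma_{(\varepsilon,\delta)}=(1-\delta)\Big(\tfrac{1}{1+e^\varepsilon}|01\rangle\langle 01|+\tfrac{e^\varepsilon}{1+e^\varepsilon}|10\rangle\langle 10|\Big)+\delta\,|11\rangle\langle 11|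 .$$ For states $\rho,\sigma$ define the following divergences. - Hockey-stick divergence, for $\gamma\ge 0$: $E_\gamma(\rho\|\sigma)=\max_{0\preceq\Lambda\preceq\mathbb I}\mathrm{Tr}[\Lambda(\rho-\gamma\sigma)]$. - Quantum $f$-divergence, for $f\in\mathcal F$, the set of convex, twice differentiable functions $f:(0,\infty)\to\mathbb R$ with $f(1)=0$: $$D_f(\rho\|\sigma)=\int_1^\infty\big(f''(\gamma)E_\gamma(\rho\|\sigma)+\gamma^{-3}f''(\gamma^{-1})E_\gamma(\sigma\|\rho)\big)\,d\gamma\in[0,\infty],$$ with value $+\infty$ if the integral is not finite. - Hockey-stick Rényi divergence, for $\alpha\in[0,1)\cup(1,\infty)$: $D_\alpha(\rho\|\sigma)=\frac1{\alpha-1}\log\big(1+(\alpha-1)H_\alpha(\rho\|\sigma)\big)$, where for $\alpha\neq0$ $$H_\alpha(\rho\|\sigma)=\alpha\int_1^\infty\big(\gamma^{\alpha-2}E_\gamma(\rho\|\sigma)+\gamma^{-\alpha-1}E_\gamma(\sigma\|\rho)\big)\,d\gamma\in[0,\infty]$$ and $H_0(\rho\|\sigma)=\lim_{\alpha\downarrow0}H_\alpha(\rho\|\sigma)$,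 with $\log0=-\infty$ and $\log\infty=\infty$. (Thus $D_\alpha(\rho\|\sigma)=+\infty$ if $\alpha<1$ and $\rho\perp\sigma$, or if $\alpha>1$ and $\mathrm{supp}\,\rho\not\subseteq\mathrm{supp}\,\sigma$.) - Quantum relative entropy: $D(\rho\|\sigma)=\mathrm{Tr}[\rho(\log\rho-\log\sigma)]$ if $\mathrm{supp}\,\rho\subseteq\mathrm{supp}\,\sigma$, and $+\infty$ otherwise. - Measured Rényi divergence, for $\alpha\in[0,1)\cup(1,\infty)$: $\check D_\alpha(\rho\|\sigma)=\sup_M\frac1{\alpha-1}\log\sum_{i:\,p_i>0}p_i^{\alpha}q_i^{1-\alpha}$, where $M=\{M_i\}$ ranges over POVMs with finitely many outcomes, $p_i=\mathrm{Tr}[\rho M_i]$ and $q_i=\mathrm{Tr}[\sigma M_i]$; here $0^{1-\alpha}=\infty$ if $\alpha>1$, and again $\log0=-\infty$, $\log\infty=\infty$. **Theorem.** Let $\varepsilon\ge0$, $\delta\in[0,1]$, and let $(\rho,\sigma)$ be an $(\varepsilon,\delta)$-DP pair of states on a finite-dimensional space. Then, as inequalities in $[-\infty,\infty]$, $$D_f(\rho\|\sigma)\le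 D_f(\rho_{(\varepsilon,\delta)}\|\sigma_{(\varepsilon,\delta)})\quad\text{for every } f\in\mathcal F,$$ $$E_\gamma(\rho\|\sigma)\le E_\gamma(\rho_{(\varepsilon,\delta)}\|\sigma_{(\varepsilon,\delta)})\quad\text{for every }\gamma\ge0,$$ $$D_\alpha(\rho\|\sigma)\le D_\alpha(\rho_{(\varepsilon,\delta)}\|\sigma_{(\varepsilon,\delta)})\quad\text{for every }\alpha\in[0,1)\cup(1,\infty),$$ $$D(\rho\|\sigma)\le D(\rho_{(\varepsilon,\delta)}\|\sigma_{(\varepsilon,\delta)}),$$ $$\check D_\alpha(\rho\|\sigma)\le\check D_\alpha(\rho_{(\varepsilon,\delta)}\|\sigma_{(\varepsilon,\delta)})\quad\text{for every }\alpha\in[0,1)\cup(1,\infty).$$ -/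

import Mathlib

open scoped Matrix ENNReal ComplexOrder

namespace QuantumDP

noncomputable section

variable {n : Type*} [Fintype n] [DecidableEq n]

/-- Density matrices: positive semidefinite with unit trace. -/
structure IsDensity (ρ : Matrix n n ℂ) : Prop where
  posSemidef : ρ.PosSemidef
  trace_eq_one : ρ.trace = 1

/-- Tests (effects): `0 ≤ Λ ≤ 1` in the Loewner order. -/
structure IsTest (Λ : Matrix n n ℂ) : Prop where
  nonneg : Λ.PosSemidef
  le_one : (1 - Λ).PosSemidef

/-- The set of `(ε, δ)`-differentially private pairs of states. -/
structure IsDP (ε δ : ℝ) (ρ σ : Matrix n n ℂ) : Prop where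
  left_density : IsDensity ρ
  right_density : IsDensity σ
  left_le : ∀ Λ : Matrix n n ℂ, IsTest Λ →
    (Λ * ρ).trace.re ≤ Real.exp ε * (Λ * σ).trace.re + δ
  right_le : ∀ Λ : Matrix n n ℂ, IsTest Λ →
    (Λ * σ).trace.re ≤ Real.exp ε * (Λ * ρ).trace.re + δ

/-- Hockey-stick divergence `E_γ(ρ‖σ)`, the maximum of `Tr[Λ (ρ - γ σ)]` over tests `Λ`. -/
def hockeyStick (γ : ℝ) (ρ σ : Matrix n n ℂ) : ℝ :=
  sSup {t : ℝ | ∃ Λ : Matrix n n ℂ, IsTest Λ ∧ t = (Λ * (ρ - (γ : ℂ) • σ)).trace.re}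

/-- The class of convex, twice differentiable `f : (0, ∞) → ℝ` with `f 1 = 0`
(only the values of `f` on `(0, ∞)` matter). -/
structure IsFDivFunction (f : ℝ → ℝ) : Prop where
  convex : ConvexOn ℝ (Set.Ioi 0) f
  differentiable : ∀ x : ℝ, 0 < x → DifferentiableAt ℝ f x
  differentiable_deriv : ∀ x : ℝ, 0 < x → DifferentiableAt ℝ (deriv f) x
  map_one : f 1 = 0

/-- Quantum `f`-divergence
`∫_1^∞ (f''(γ) E_γ(ρ‖σ) + γ⁻³ f''(γ⁻¹) E_γ(σ‖ρ)) dγ`. For convex `f` the integrand is nonnegative,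
so the lower Lebesgue integral is the integral when this is finite, and `∞` otherwise. -/
def fDivergence (f : ℝ → ℝ) (ρ σ : Matrix n n ℂ) : ℝ≥0∞ :=
  ∫⁻ γ in Set.Ioi (1 : ℝ), ENNReal.ofReal
    (deriv (deriv f) γ * hockeyStick γ ρ σ
      + γ ^ (-3 : ℤ) * deriv (deriv f) γ⁻¹ * hockeyStick γ σ ρ)

/-- `α ∫_1^∞ (γ^(α-2) E_γ(ρ‖σ) + γ^(-α-1) E_γ(σ‖ρ)) dγ`, with values in `[0, ∞]`. -/
def hockeyStickIntegral (α : ℝ) (ρ σ : Matrix n n ℂ) : ℝ≥0∞ :=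
  ENNReal.ofReal α * ∫⁻ γ in Set.Ioi (1 : ℝ), ENNReal.ofReal
    (γ ^ (α - 2) * hockeyStick γ ρ σ + γ ^ (-α - 1) * hockeyStick γ σ ρ)

/-- `H_α(ρ‖σ)`. At order `0`, where the defining expression can be `0 * ∞`, the value is the limit
from the right in `α`; this agrees with the defining expression (i.e. `0`) when the integral
at order `0` is finite. -/
def hockeyStickHellinger (α : ℝ) (ρ σ : Matrix n n ℂ) : ℝ≥0∞ :=
  if α = 0 then Filter.limsup (fun a : ℝ => hockeyStickIntegral a ρ σ) (nhdsWithin 0 (Set.Ioi 0))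
  else hockeyStickIntegral α ρ σ

/-- Hockey-stick Rényi divergence `(α - 1)⁻¹ log (1 + (α - 1) H_α(ρ‖σ))`, evaluated with
`log 0 = -∞` and `log ∞ = ∞`. For states and `0 ≤ α < 1` one has `(1 - α) H_α ≤ 1`, so `toENNReal`
truncates nothing. The value is `+∞` exactly when neither `α < 1` with `ρ`, `σ` non-orthogonal,
nor `supp ρ ⊆ supp σ`. -/
def hockeyStickRenyi (α : ℝ) (ρ σ : Matrix n n ℂ) : EReal :=
  (((α - 1)⁻¹ : ℝ) : EReal) *
    ENNReal.log (1 + ((α - 1 : ℝ) : EReal) * (hockeyStickHellinger α ρ σ : EReal)).toENNReal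

open Classical in
/-- Quantum relative entropy. For Hermitian matrices `supp ρ ⊆ supp σ` says `ker σ ⊆ ker ρ`;
`cfc Real.log` is the logarithm on the support and `0` on the kernel. -/
def relativeEntropy (ρ σ : Matrix n n ℂ) : EReal :=
  if ∀ v : n → ℂ, σ *ᵥ v = 0 → ρ *ᵥ v = 0 then
    (((ρ * (cfc Real.log ρ - cfc Real.log σ)).trace.re : ℝ) : EReal)
  else ⊤

/-- Classical Rényi divergence `(α - 1)⁻¹ log ∑ P^α Q^(1-α)` of distributions on a finite set,
the sum being over the support of `P` and taken in `[0, ∞]`. -/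
def classicalRenyi {ι : Type*} [Fintype ι] (α : ℝ) (P Q : ι → ℝ) : EReal :=
  (((α - 1)⁻¹ : ℝ) : EReal) *
    ENNReal.log (∑ i, if 0 < P i then ENNReal.ofReal (P i) ^ α * ENNReal.ofReal (Q i) ^ (1 - α)
      else 0)

/-- Positive operator-valued measures with finitely many outcomes. -/
structure IsPOVM {k : ℕ} (M : Fin k → Matrix n n ℂ) : Prop where
  nonneg : ∀ i, (M i).PosSemidef
  sum_eq_one : ∑ i, M i = 1

/-- Measured Rényi divergence: supremum of the classical Rényi divergence of the outcome
distributions `i ↦ Tr[ρ M i]`, `i ↦ Tr[σ M i]` over all measurements. -/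
def measuredRenyi (α : ℝ) (ρ σ : Matrix n n ℂ) : EReal :=
  ⨆ (k : ℕ) (M : Fin k → Matrix n n ℂ) (_ : IsPOVM M),
    classicalRenyi α (fun i => (ρ * M i).trace.re) (fun i => (σ * M i).trace.re)

/-- The state `δ |00⟩⟨00| + (1-δ) (e^ε/(1+e^ε) |01⟩⟨01| + 1/(1+e^ε) |10⟩⟨10|)`, in the ordered basis
`|00⟩, |01⟩, |10⟩, |11⟩`. -/
def weakestRho (ε δ : ℝ) : Matrix (Fin 4) (Fin 4) ℂ :=
  Matrix.diagonal fun i => ((![δ, (1 - δ) * (Real.exp ε / (1 + Real.exp ε)),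
    (1 - δ) * (1 / (1 + Real.exp ε)), 0] i : ℝ) : ℂ)

/-- The state `(1-δ) (1/(1+e^ε) |01⟩⟨01| + e^ε/(1+e^ε) |10⟩⟨10|) + δ |11⟩⟨11|`, in the same basis. -/
def weakestSigma (ε δ : ℝ) : Matrix (Fin 4) (Fin 4) ℂ :=
  Matrix.diagonal fun i => ((![0, (1 - δ) * (1 / (1 + Real.exp ε)),
    (1 - δ) * (Real.exp ε / (1 + Real.exp ε)), δ] i : ℝ) : ℂ)

end

end QuantumDP

/-! Write `b` for `e^ε`. The model pair is classical: a δ-part where the states are perfectly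
distinguishable, and otherwise likelihood ratios exactly `b` and `b⁻¹`, the extremes that privacy
allows.

Hockey-stick type divergences: a test enters only through `(x, y) = (Tr[Λρ], Tr[Λσ])`, and privacy
applied to `Λ` and to `1 - Λ` gives two linear constraints on this point. Maximising `x - γ y` under
them is a small linear program whose value the model pair attains with diagonal 0/1 tests
(`hockeyStick_le_weakest`). The f-divergences and hockey-stick Rényi divergences are monotone in the
functions `γ ↦ E_γ`.

Measured Rényi: a measurement yields distributions that are private on every event. Comparing `r ^
α` with its chord over `[b⁻¹, b]` gives a bound that is tight when all ratios are endpoints. For `α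
< 1` and `δ > 0`, truncating to `min P (bQ)` and `min Q (bP)` loses mass at most δ; for `α > 1` and
`δ > 0` the model value is infinite.

Relative entropy: only `δ = 0` has content. Then `σ = X + Y` and `ρ = b⁻¹ X + b Y` with `X`, `Y`
positive semidefinite. Along the segment from `σ` to `ρ`, with direction `Δ`, the second derivative
of the relative entropy to `σ` is at most `Tr[ω⁻¹ Δ²]`, since the logarithmic difference quotient is
at most the mean of the inverses. Joint convexity of `Tr[ω⁻¹ Δ²]` bounds this by its commuting
value. Integrating twice (`trace_mul_log_sub_log_le`) gives the model's relative entropy. The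
integrations are done discretely: increments bounded by a multiple of the squared step replace
derivatives. -/

namespace QuantumDP

/-! ### Traces, tests and complements -/

section Matrices

variable {n : Type*}

open scoped MatrixOrder in
theorem trace_mul_re_nonneg [Fintype n] {A B : Matrix n n ℂ} (hA : A.PosSemidef) (hB : B.PosSemidef) :
    0 ≤ (A * B).trace.re := by
  classical
  obtain ⟨C, rfl⟩ := CStarAlgebra.nonneg_iff_eq_star_mul_self.mp hA.nonneg
  rw [Matrix.mul_assoc, Matrix.trace_mul_comm, Matrix.mul_assoc]
  have h := (hB.mul_mul_conjTranspose_same C).trace_nonneg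
  rw [Matrix.mul_assoc] at h
  exact (Complex.le_def.mp h).1

theorem trace_re_nonneg [Fintype n] {A : Matrix n n ℂ} (hA : A.PosSemidef) : 0 ≤ A.trace.re :=
  (Complex.le_def.mp hA.trace_nonneg).1

variable [DecidableEq n]

theorem IsTest.compl {Λ : Matrix n n ℂ} (h : IsTest Λ) : IsTest (1 - Λ) :=
  ⟨h.le_one, by simpa using h.nonneg⟩

theorem isTest_zero : IsTest (0 : Matrix n n ℂ) :=
  ⟨Matrix.PosSemidef.zero, by simpa using Matrix.PosSemidef.one⟩

theorem isTest_diagonal {d : n → ℝ} (h₀ : ∀ i, 0 ≤ d i) (h₁ : ∀ i, d i ≤ 1) :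
    IsTest (Matrix.diagonal fun i => ((d i : ℝ) : ℂ)) := by
  refine ⟨Matrix.posSemidef_diagonal_iff.mpr fun i => by exact_mod_cast h₀ i, ?_⟩
  rw [← Matrix.diagonal_one, Matrix.diagonal_sub]
  refine Matrix.posSemidef_diagonal_iff.mpr fun i => ?_
  have := sub_nonneg.mpr (h₁ i)
  exact_mod_cast this

variable [Fintype n]

theorem trace_compl_mul_re {Λ ρ : Matrix n n ℂ} (hρ : IsDensity ρ) :
    ((1 - Λ) * ρ).trace.re = 1 - (Λ * ρ).trace.re := by
  simp [sub_mul, Matrix.trace_sub, hρ.trace_eq_one]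

theorem trace_mul_sub_smul_re (γ : ℝ) (Λ ρ σ : Matrix n n ℂ) :
    (Λ * (ρ - (γ : ℂ) • σ)).trace.re = (Λ * ρ).trace.re - γ * (Λ * σ).trace.re := by
  simp [mul_sub, Matrix.trace_sub]

theorem IsTest.trace_mul_re_le_one {Λ ρ : Matrix n n ℂ} (h : IsTest Λ) (hρ : IsDensity ρ) :
    (Λ * ρ).trace.re ≤ 1 := by
  have := trace_mul_re_nonneg h.le_one hρ.posSemidef
  rw [trace_compl_mul_re hρ] at this
  linarith

theorem IsDP.symm {ε δ : ℝ} {ρ σ : Matrix n n ℂ} (h : IsDP ε δ ρ σ) : IsDP ε δ σ ρ :=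
  ⟨h.right_density, h.left_density, h.right_le, h.left_le⟩

end Matrices

/-! ### Hockey-stick divergences and the divergences integrated from them -/

section HockeyStick

variable {n : Type*} [Fintype n] [DecidableEq n]

theorem bddAbove_hockeyStick {γ : ℝ} (hγ : 0 ≤ γ) {ρ σ : Matrix n n ℂ} (hρ : IsDensity ρ)
    (hσ : IsDensity σ) :
    BddAbove {t : ℝ | ∃ Λ : Matrix n n ℂ, IsTest Λ ∧ t = (Λ * (ρ - (γ : ℂ) • σ)).trace.re} := by
  refine ⟨1, ?_⟩
  rintro _ ⟨Λ, hΛ, rfl⟩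
  rw [trace_mul_sub_smul_re]
  have := mul_nonneg hγ (trace_mul_re_nonneg hΛ.nonneg hσ.posSemidef)
  linarith [hΛ.trace_mul_re_le_one hρ]

theorem le_hockeyStick {γ : ℝ} (hγ : 0 ≤ γ) {ρ σ : Matrix n n ℂ} (hρ : IsDensity ρ)
    (hσ : IsDensity σ) {Λ : Matrix n n ℂ} (hΛ : IsTest Λ) :
    (Λ * ρ).trace.re - γ * (Λ * σ).trace.re ≤ hockeyStick γ ρ σ :=
  le_csSup (bddAbove_hockeyStick hγ hρ hσ) ⟨Λ, hΛ, (trace_mul_sub_smul_re γ Λ ρ σ).symm⟩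

theorem hockeyStick_le {γ c : ℝ} {ρ σ : Matrix n n ℂ}
    (h : ∀ Λ, IsTest Λ → (Λ * ρ).trace.re - γ * (Λ * σ).trace.re ≤ c) :
    hockeyStick γ ρ σ ≤ c := by
  refine csSup_le ⟨_, 0, isTest_zero, rfl⟩ ?_
  rintro _ ⟨Λ, hΛ, rfl⟩
  rw [trace_mul_sub_smul_re]
  exact h Λ hΛ

theorem isDensity_weakestRho {ε δ : ℝ} (hδ₀ : 0 ≤ δ) (hδ₁ : δ ≤ 1) :
    IsDensity (weakestRho ε δ) := by
  have hb := Real.exp_pos ε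
  refine ⟨Matrix.posSemidef_diagonal_iff.mpr fun i => ?_, ?_⟩
  · rw [Complex.zero_le_real]
    have := sub_nonneg.mpr hδ₁
    fin_cases i <;> simp <;> positivity
  · rw [weakestRho, Matrix.trace_diagonal, ← Complex.ofReal_sum, Fin.sum_univ_four]
    norm_cast
    simp
    field_simp
    ring

theorem isDensity_weakestSigma {ε δ : ℝ} (hδ₀ : 0 ≤ δ) (hδ₁ : δ ≤ 1) :
    IsDensity (weakestSigma ε δ) := by
  have hb := Real.exp_pos ε
  refine ⟨Matrix.posSemidef_diagonal_iff.mpr fun i => ?_, ?_⟩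
  · rw [Complex.zero_le_real]
    have := sub_nonneg.mpr hδ₁
    fin_cases i <;> simp <;> positivity
  · rw [weakestSigma, Matrix.trace_diagonal, ← Complex.ofReal_sum, Fin.sum_univ_four]
    norm_cast
    simp
    field_simp
    ring

theorem trace_diagonal_mul_diagonal_re (d e : n → ℝ) :
    (Matrix.diagonal (fun i => ((d i : ℝ) : ℂ)) * Matrix.diagonal fun i => ((e i : ℝ) : ℂ)).trace.re
      = ∑ i, d i * e i := by
  simp [Matrix.diagonal_mul_diagonal, Matrix.trace_diagonal]

theorem weakest_le_hockeyStick {ε δ γ : ℝ} (hδ₀ : 0 ≤ δ) (hδ₁ : δ ≤ 1) (hγ : 0 ≤ γ)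
    (d : Fin 4 → ℝ) (h₀ : ∀ i, 0 ≤ d i) (h₁ : ∀ i, d i ≤ 1) :
    (d 0 * δ + d 1 * ((1 - δ) * (Real.exp ε / (1 + Real.exp ε)))
      + d 2 * ((1 - δ) * (1 / (1 + Real.exp ε))))
      - γ * (d 1 * ((1 - δ) * (1 / (1 + Real.exp ε)))
        + d 2 * ((1 - δ) * (Real.exp ε / (1 + Real.exp ε))) + d 3 * δ)
      ≤ hockeyStick γ (weakestRho ε δ) (weakestSigma ε δ) := by
  have h := le_hockeyStick hγ (isDensity_weakestRho (ε := ε) hδ₀ hδ₁)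
    (isDensity_weakestSigma (ε := ε) hδ₀ hδ₁) (isTest_diagonal h₀ h₁)
  have h₂ : (Matrix.diagonal (fun i => ((d i : ℝ) : ℂ)) * weakestRho ε δ).trace.re
      = d 0 * δ + d 1 * ((1 - δ) * (Real.exp ε / (1 + Real.exp ε)))
        + d 2 * ((1 - δ) * (1 / (1 + Real.exp ε))) := by
    rw [weakestRho, trace_diagonal_mul_diagonal_re, Fin.sum_univ_four]
    simp
  have h₃ : (Matrix.diagonal (fun i => ((d i : ℝ) : ℂ)) * weakestSigma ε δ).trace.re
      = d 1 * ((1 - δ) * (1 / (1 + Real.exp ε)))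
        + d 2 * ((1 - δ) * (Real.exp ε / (1 + Real.exp ε))) + d 3 * δ := by
    rw [weakestSigma, trace_diagonal_mul_diagonal_re, Fin.sum_univ_four]
    simp
  rwa [h₂, h₃] at h

/-- The three ranges of `γ` correspond to the three vertices of the region cut out by the privacy
constraints and `x ≤ 1`, `0 ≤ y`; each vertex is realised by accepting an initial block of the
model's basis. -/
theorem hockeyStick_le_weakest {ε δ : ℝ} (hε : 0 ≤ ε) (hδ₀ : 0 ≤ δ) (hδ₁ : δ ≤ 1)
    {ρ σ : Matrix n n ℂ} (h : IsDP ε δ ρ σ) {γ : ℝ} (hγ : 0 ≤ γ) :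
    hockeyStick γ ρ σ ≤ hockeyStick γ (weakestRho ε δ) (weakestSigma ε δ) := by
  refine hockeyStick_le fun Λ hΛ => ?_
  have hx := h.left_le Λ hΛ
  have hy := h.right_le _ hΛ.compl
  rw [trace_compl_mul_re h.left_density, trace_compl_mul_re h.right_density] at hy
  have hx₁ := hΛ.trace_mul_re_le_one h.left_density
  have hy₀ := trace_mul_re_nonneg hΛ.nonneg h.right_density.posSemidef
  have key := weakest_le_hockeyStick (ε := ε) hδ₀ hδ₁ hγ
  have hb : 1 ≤ Real.exp ε := Real.one_le_exp hε
  set b := Real.exp ε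
  set x := (Λ * ρ).trace.re
  set y := (Λ * σ).trace.re
  have hb0 : 0 < b := by linarith
  rcases le_total b γ with hbγ | hbγ
  · refine le_trans ?_ (key ![1, 0, 0, 0] (by simp [Fin.forall_fin_succ])
      (by simp [Fin.forall_fin_succ]))
    simp
    nlinarith [mul_nonneg (sub_nonneg.mpr hbγ) hy₀]
  rcases le_total (γ * b) 1 with hbγ' | hbγ'
  · refine le_trans ?_ (key ![1, 1, 1, 0] (by simp [Fin.forall_fin_succ])
      (by simp [Fin.forall_fin_succ]))
    simp
    have e : δ + (1 - δ) * (b / (1 + b)) + (1 - δ) * (1 + b)⁻¹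
        - γ * ((1 - δ) * (1 + b)⁻¹ + (1 - δ) * (b / (1 + b))) = 1 - γ * (1 - δ) := by
      field_simp
      ring
    have h1 : x - γ * y ≤ 1 - γ * (1 - δ) := by
      nlinarith [mul_le_mul_of_nonneg_left hy hγ, mul_nonneg (sub_nonneg.mpr hbγ')
        (sub_nonneg.mpr hx₁)]
    linarith
  · refine le_trans ?_ (key ![1, 1, 0, 0] (by simp [Fin.forall_fin_succ])
      (by simp [Fin.forall_fin_succ]))
    simp
    have e : δ + (1 - δ) * (b / (1 + b)) - γ * ((1 - δ) * (1 + b)⁻¹)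
        = (δ * (1 + b) + (1 - δ) * (b - γ)) / (1 + b) := by
      field_simp
      ring
    suffices x - γ * y ≤ (δ * (1 + b) + (1 - δ) * (b - γ)) / (1 + b) by linarith
    rw [le_div_iff₀ (by linarith)]
    -- The combination used for `b > 1` carries a common factor `b - 1`, which vanishes for `b = 1`;
    -- then `γ = 1` and one constraint suffices.
    rcases hb.eq_or_lt with hb1 | hb1
    · have hγ1 : γ = 1 := le_antisymm (hb1 ▸ hbγ) (by rw [← hb1] at hbγ'; linarith)
      rw [← hb1, hγ1]
      rw [← hb1] at hx
      linarith
    -- Dual multipliers `γ b - 1` and `b - γ`: the weighted sum of the constraints is `(b - 1)`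
    -- times the goal.
    · have h1 := mul_le_mul_of_nonneg_left hx (sub_nonneg.mpr hbγ')
      have h2 := mul_le_mul_of_nonneg_left hy (sub_nonneg.mpr hbγ)
      refine le_of_mul_le_mul_left ?_ (sub_pos.mpr hb1)
      nlinarith

/-- Passing from `Λ` to `1 - Λ` exchanges the two states, since both traces are one. -/
theorem hockeyStick_swap_le {γ : ℝ} (hγ : 0 < γ) {ρ σ : Matrix n n ℂ} (hρ : IsDensity ρ)
    (hσ : IsDensity σ) : hockeyStick γ σ ρ ≤ 1 - γ + γ * hockeyStick γ⁻¹ ρ σ := by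
  refine hockeyStick_le fun Λ hΛ => ?_
  have h := mul_le_mul_of_nonneg_left
    (le_hockeyStick (inv_nonneg.mpr hγ.le) hρ hσ hΛ.compl) hγ.le
  rw [trace_compl_mul_re hρ, trace_compl_mul_re hσ, mul_sub, mul_inv_cancel_left₀ hγ.ne'] at h
  linarith

/-- Swapping forth for the given pair and back for the model pair, at `γ` and `γ⁻¹`, avoids any
appeal to the model's basis-reversal symmetry. -/
theorem hockeyStick_swap_le_weakest {ε δ : ℝ} (hε : 0 ≤ ε) (hδ₀ : 0 ≤ δ) (hδ₁ : δ ≤ 1)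
    {ρ σ : Matrix n n ℂ} (h : IsDP ε δ ρ σ) {γ : ℝ} (hγ : 0 < γ) :
    hockeyStick γ σ ρ ≤ hockeyStick γ (weakestSigma ε δ) (weakestRho ε δ) := by
  have h₁ := hockeyStick_swap_le hγ h.left_density h.right_density
  have h₂ := hockeyStick_swap_le (inv_pos.mpr hγ) (isDensity_weakestSigma (ε := ε) hδ₀ hδ₁)
    (isDensity_weakestRho (ε := ε) hδ₀ hδ₁)
  have h₃ := hockeyStick_le_weakest hε hδ₀ hδ₁ h (inv_nonneg.mpr hγ.le)
  have h₄ := mul_le_mul_of_nonneg_left (h₃.trans h₂) hγ.le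
  rw [inv_inv, mul_add, mul_sub, mul_inv_cancel_left₀ hγ.ne', mul_inv_cancel₀ hγ.ne'] at h₄
  linarith

theorem IsFDivFunction.deriv_deriv_nonneg {f : ℝ → ℝ} (hf : IsFDivFunction f) {x : ℝ}
    (hx : 0 < x) : 0 ≤ deriv (deriv f) x := by
  have h := (hf.convex.monotoneOn_deriv hf.differentiable).derivWithin_nonneg (x := x)
  rwa [derivWithin_of_isOpen isOpen_Ioi hx] at h

theorem fDivergence_le_weakest {ε δ : ℝ} (hε : 0 ≤ ε) (hδ₀ : 0 ≤ δ) (hδ₁ : δ ≤ 1)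
    {ρ σ : Matrix n n ℂ} (h : IsDP ε δ ρ σ)
    {f : ℝ → ℝ} (hf : IsFDivFunction f) :
    fDivergence f ρ σ ≤ fDivergence f (weakestRho ε δ) (weakestSigma ε δ) := by
  refine MeasureTheory.setLIntegral_mono' measurableSet_Ioi fun γ hγ => ENNReal.ofReal_le_ofReal ?_
  have hγ₀ : 0 < γ := one_pos.trans hγ
  refine add_le_add
    (mul_le_mul_of_nonneg_left (hockeyStick_le_weakest hε hδ₀ hδ₁ h hγ₀.le)
      (hf.deriv_deriv_nonneg hγ₀))
    (mul_le_mul_of_nonneg_left (hockeyStick_swap_le_weakest hε hδ₀ hδ₁ h hγ₀)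
      (mul_nonneg (by positivity) (hf.deriv_deriv_nonneg (inv_pos.mpr hγ₀))))

theorem hockeyStickIntegral_le_weakest {ε δ : ℝ} (hε : 0 ≤ ε) (hδ₀ : 0 ≤ δ) (hδ₁ : δ ≤ 1)
    {ρ σ : Matrix n n ℂ} (h : IsDP ε δ ρ σ) (α : ℝ) :
    hockeyStickIntegral α ρ σ ≤ hockeyStickIntegral α (weakestRho ε δ) (weakestSigma ε δ) := by
  refine mul_le_mul_right (MeasureTheory.setLIntegral_mono' measurableSet_Ioi fun γ hγ =>
    ENNReal.ofReal_le_ofReal ?_) _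
  have hγ₀ : 0 < γ := one_pos.trans hγ
  exact add_le_add
    (mul_le_mul_of_nonneg_left (hockeyStick_le_weakest hε hδ₀ hδ₁ h hγ₀.le) (by positivity))
    (mul_le_mul_of_nonneg_left (hockeyStick_swap_le_weakest hε hδ₀ hδ₁ h hγ₀) (by positivity))

theorem hockeyStickHellinger_le_weakest {ε δ : ℝ} (hε : 0 ≤ ε) (hδ₀ : 0 ≤ δ) (hδ₁ : δ ≤ 1)
    {ρ σ : Matrix n n ℂ} (h : IsDP ε δ ρ σ) (α : ℝ) :
    hockeyStickHellinger α ρ σ ≤ hockeyStickHellinger α (weakestRho ε δ) (weakestSigma ε δ) := by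
  unfold hockeyStickHellinger
  split_ifs
  · exact Filter.limsup_le_limsup
      (Filter.Eventually.of_forall fun a => hockeyStickIntegral_le_weakest hε hδ₀ hδ₁ h a)
  · exact hockeyStickIntegral_le_weakest hε hδ₀ hδ₁ h α

theorem ereal_mul_le_mul_of_nonpos_left {a b c : EReal} (h : b ≤ c) (ha : a ≤ 0) :
    a * c ≤ a * b := by
  have h' := mul_le_mul_of_nonneg_left h (EReal.neg_nonneg.mpr ha)
  rwa [EReal.neg_mul, EReal.neg_mul, EReal.neg_le_neg_iff] at h'

theorem hockeyStickRenyi_le_weakest {ε δ : ℝ} (hε : 0 ≤ ε) (hδ₀ : 0 ≤ δ) (hδ₁ : δ ≤ 1)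
    {ρ σ : Matrix n n ℂ} (h : IsDP ε δ ρ σ) (α : ℝ) :
    hockeyStickRenyi α ρ σ ≤ hockeyStickRenyi α (weakestRho ε δ) (weakestSigma ε δ) := by
  have hH : (hockeyStickHellinger α ρ σ : EReal)
      ≤ hockeyStickHellinger α (weakestRho ε δ) (weakestSigma ε δ) :=
    EReal.coe_ennreal_le_coe_ennreal_iff.mpr (hockeyStickHellinger_le_weakest hε hδ₀ hδ₁ h α)
  rcases le_total 1 α with hα | hα
  · refine mul_le_mul_of_nonneg_left (ENNReal.log_le_log (EReal.toENNReal_le_toENNReal ?_))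
      (EReal.coe_nonneg.mpr (inv_nonneg.mpr (sub_nonneg.mpr hα)))
    exact add_le_add le_rfl
      (mul_le_mul_of_nonneg_left hH (EReal.coe_nonneg.mpr (sub_nonneg.mpr hα)))
  -- Both the factor inside the logarithm and the prefactor are nonpositive, so the order reverses
  -- twice.
  · refine ereal_mul_le_mul_of_nonpos_left (ENNReal.log_le_log (EReal.toENNReal_le_toENNReal ?_))
      (EReal.coe_nonpos.mpr (inv_nonpos.mpr (sub_nonpos.mpr hα)))
    exact add_le_add le_rfl
      (ereal_mul_le_mul_of_nonpos_left hH (EReal.coe_nonpos.mpr (sub_nonpos.mpr hα)))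

end HockeyStick

/-! ### Chord bounds for power functions -/

section Chord

/-- The slope-intercept form of the chord of `r ↦ r ^ α` over `[b⁻¹, b]`. -/
theorem rpow_chord {b : ℝ} (hb : 1 < b) (α r : ℝ) :
    (b * (b - r) / (b ^ 2 - 1)) * (b⁻¹ ^ α) + ((b * r - 1) / (b ^ 2 - 1)) * b ^ α
      = (b * b ^ α - b ^ (1 - α)) / (b ^ 2 - 1) * r
        + (b * b ^ (1 - α) - b ^ α) / (b ^ 2 - 1) := by
  have hb0 : 0 < b := by linarith
  have hb2 : b ^ 2 - 1 ≠ 0 := by nlinarith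
  rw [Real.inv_rpow hb0.le, Real.rpow_sub hb0, Real.rpow_one]
  have := (Real.rpow_pos_of_pos hb0 α).ne'
  field_simp
  ring

/-- This is the chord's value at `r = 1`, which is also the model pair's power sum for `δ = 0`. -/
theorem chord_coeff_add {b : ℝ} (hb : 1 < b) (α : ℝ) :
    (b * b ^ α - b ^ (1 - α)) / (b ^ 2 - 1) + (b * b ^ (1 - α) - b ^ α) / (b ^ 2 - 1)
      = (b ^ α + b ^ (1 - α)) / (1 + b) := by
  have hb2 : b ^ 2 - 1 ≠ 0 := by nlinarith
  have : 1 + b ≠ 0 := by linarith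
  field_simp
  ring

theorem rpow_mul_rpow_one_sub_eq {x y : ℝ} (hx : 0 ≤ x) (hy : 0 < y) (α : ℝ) :
    x ^ α * y ^ (1 - α) = (x / y) ^ α * y := by
  have := (Real.rpow_pos_of_pos hy α).ne'
  rw [Real.div_rpow hx hy.le, Real.rpow_sub hy, Real.rpow_one]
  field_simp

theorem rpow_mul_rpow_one_sub_self {x : ℝ} (hx : 0 < x) (α : ℝ) : x ^ α * x ^ (1 - α) = x := by
  rw [← Real.rpow_add hx, add_sub_cancel, Real.rpow_one]

/-- In the cone `b⁻¹ y ≤ x ≤ b y` the concave function `x ^ α * y ^ (1 - α)` lies above the linear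
function that agrees with it on the boundary of the cone. -/
theorem exists_linear_le_rpow_mul_rpow {b α : ℝ} (hb : 1 ≤ b) (hα₀ : 0 ≤ α) (hα₁ : α < 1) :
    ∃ A B : ℝ, 0 ≤ A ∧ 0 ≤ B ∧ A + B = (b ^ α + b ^ (1 - α)) / (1 + b) ∧
      ∀ x y : ℝ, 0 < x → 0 < y → x ≤ b * y → y ≤ b * x → A * x + B * y ≤ x ^ α * y ^ (1 - α) := by
  rcases hb.eq_or_lt with rfl | hb
  · refine ⟨1, 0, by simp, le_rfl, by norm_num, fun x y hx hy h₁ h₂ => ?_⟩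
    obtain rfl : x = y := le_antisymm (by simpa using h₁) (by simpa using h₂)
    simp [rpow_mul_rpow_one_sub_self hx]
  have hb0 : 0 < b := by linarith
  have hb2 : 0 < b ^ 2 - 1 := by nlinarith
  -- With `u = b ^ α`, `v = b ^ (1 - α)` and `u v = b`, the numerators are `v (u² - 1)` and `u (v² -
  -- 1)`, hence nonnegative.
  have h1 : 1 ≤ b ^ α := Real.one_le_rpow hb.le hα₀
  have h2 : 1 ≤ b ^ (1 - α) := Real.one_le_rpow hb.le (by linarith)
  have h3 := rpow_mul_rpow_one_sub_self hb0 α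
  refine ⟨_, _, div_nonneg ?_ hb2.le, div_nonneg ?_ hb2.le, chord_coeff_add hb α,
    fun x y hx hy hxy hyx => ?_⟩
  · nlinarith
  · nlinarith
  have hr₁ : x / y ≤ b := (div_le_iff₀ hy).mpr hxy
  have hr₂ : 1 ≤ b * (x / y) := by rwa [← mul_div_assoc, one_le_div hy]
  -- Barycentric weights of `x / y` with respect to the endpoints `b⁻¹` and `b`.
  have hw₁ : 0 ≤ b * (b - x / y) / (b ^ 2 - 1) :=
    div_nonneg (mul_nonneg hb0.le (by linarith)) hb2.le
  have hw₂ : 0 ≤ (b * (x / y) - 1) / (b ^ 2 - 1) := div_nonneg (by linarith) hb2.le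
  have hc := And.right (Real.concaveOn_rpow hα₀ hα₁.le) (Set.mem_Ici.mpr (inv_nonneg.mpr hb0.le)) (Set.mem_Ici.mpr hb0.le)
    hw₁ hw₂ (by field_simp; ring)
  simp only [smul_eq_mul] at hc
  rw [rpow_chord hb] at hc
  have e : b * (b - x / y) / (b ^ 2 - 1) * b⁻¹ + (b * (x / y) - 1) / (b ^ 2 - 1) * b = x / y := by
    field_simp
    ring
  rw [e] at hc
  rw [rpow_mul_rpow_one_sub_eq hx.le hy]
  refine le_trans (le_of_eq ?_) (mul_le_mul_of_nonneg_right hc hy.le)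
  field_simp

/-- For `α > 1` the power is convex and lies below its chord. It is applied without truncation, so
the signs of the coefficients do not matter. -/
theorem exists_rpow_mul_rpow_le_linear {b α : ℝ} (hb : 1 ≤ b) (hα₁ : 1 < α) :
    ∃ A B : ℝ, A + B = (b ^ α + b ^ (1 - α)) / (1 + b) ∧
      ∀ x y : ℝ, 0 < x → 0 < y → x ≤ b * y → y ≤ b * x → x ^ α * y ^ (1 - α) ≤ A * x + B * y := by
  rcases hb.eq_or_lt with rfl | hb
  · refine ⟨1, 0, by norm_num, fun x y hx hy h₁ h₂ => ?_⟩
    obtain rfl : x = y := le_antisymm (by simpa using h₁) (by simpa using h₂)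
    simp [rpow_mul_rpow_one_sub_self hx]
  have hb0 : 0 < b := by linarith
  have hb2 : 0 < b ^ 2 - 1 := by nlinarith
  refine ⟨_, _, chord_coeff_add hb α, fun x y hx hy hxy hyx => ?_⟩
  have hr₁ : x / y ≤ b := (div_le_iff₀ hy).mpr hxy
  have hr₂ : 1 ≤ b * (x / y) := by rwa [← mul_div_assoc, one_le_div hy]
  have hw₁ : 0 ≤ b * (b - x / y) / (b ^ 2 - 1) :=
    div_nonneg (mul_nonneg hb0.le (by linarith)) hb2.le
  have hw₂ : 0 ≤ (b * (x / y) - 1) / (b ^ 2 - 1) := div_nonneg (by linarith) hb2.le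
  have hc := And.right (convexOn_rpow hα₁.le) (Set.mem_Ici.mpr (inv_nonneg.mpr hb0.le)) (Set.mem_Ici.mpr hb0.le)
    hw₁ hw₂ (by field_simp; ring)
  simp only [smul_eq_mul] at hc
  rw [rpow_chord hb] at hc
  have e : b * (b - x / y) / (b ^ 2 - 1) * b⁻¹ + (b * (x / y) - 1) / (b ^ 2 - 1) * b = x / y := by
    field_simp
    ring
  rw [e] at hc
  rw [rpow_mul_rpow_one_sub_eq hx.le hy]
  refine le_trans (mul_le_mul_of_nonneg_right hc hy.le) (le_of_eq ?_)
  field_simp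

end Chord

/-! ### Power sums of private pairs of distributions -/

section Classical

variable {ι : Type*} [Fintype ι] {P Q : ι → ℝ} {b δ α : ℝ}

/-- The mass removed by truncation is `P(S) - b Q(S)` for `S = {b Q < P}`, so privacy on that single
event bounds it by δ. -/
theorem one_sub_le_sum_min (hP : ∑ i, P i = 1)
    (h : ∀ S : Finset ι, ∑ i ∈ S, P i ≤ b * ∑ i ∈ S, Q i + δ) :
    1 - δ ≤ ∑ i, min (P i) (b * Q i) := by
  classical
  have hS := h (Finset.univ.filter fun i => b * Q i < P i)
  have e : ∑ i, min (P i) (b * Q i) = ∑ i, P i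
      - (∑ i ∈ Finset.univ.filter (fun i => b * Q i < P i), P i
        - b * ∑ i ∈ Finset.univ.filter (fun i => b * Q i < P i), Q i) := by
    rw [Finset.mul_sum, ← Finset.sum_sub_distrib, Finset.sum_filter, ← Finset.sum_sub_distrib]
    refine Finset.sum_congr rfl fun i _ => ?_
    split_ifs with hi
    · rw [min_eq_right hi.le]; ring
    · rw [min_eq_left (not_lt.mp hi)]; ring
  rw [e, hP]
  linarith

/-- The truncated pair lies in the cone where the chord bound holds. Truncation only decreases the
power sum, both exponents being nonnegative, and nonnegative chord coefficients turn the mass bounds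
into the claim. -/
theorem le_sum_rpow_mul_rpow (hb : 1 ≤ b) (hα₀ : 0 ≤ α) (hα₁ : α < 1)
    (hP₀ : ∀ i, 0 ≤ P i) (hQ₀ : ∀ i, 0 ≤ Q i) (hP : ∑ i, P i = 1) (hQ : ∑ i, Q i = 1)
    (hPQ : ∀ S : Finset ι, ∑ i ∈ S, P i ≤ b * ∑ i ∈ S, Q i + δ)
    (hQP : ∀ S : Finset ι, ∑ i ∈ S, Q i ≤ b * ∑ i ∈ S, P i + δ) :
    (1 - δ) * ((b ^ α + b ^ (1 - α)) / (1 + b))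
      ≤ ∑ i, if 0 < P i then P i ^ α * Q i ^ (1 - α) else 0 := by
  obtain ⟨A, B, hA, hB, hAB, h⟩ := exists_linear_le_rpow_mul_rpow hb hα₀ hα₁
  have hb0 : 0 < b := by linarith
  have h₁ := mul_le_mul_of_nonneg_left (one_sub_le_sum_min hP hPQ) hA
  have h₂ := mul_le_mul_of_nonneg_left (one_sub_le_sum_min hQ hQP) hB
  rw [← hAB]
  calc (1 - δ) * (A + B) ≤ ∑ i, (A * min (P i) (b * Q i) + B * min (Q i) (b * P i)) := by
        rw [Finset.sum_add_distrib, ← Finset.mul_sum, ← Finset.mul_sum]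
        linarith
    _ ≤ _ := Finset.sum_le_sum fun i _ => ?_
  have hp := hP₀ i
  have hq := hQ₀ i
  split_ifs with hi
  · rcases hq.eq_or_lt with hq0 | hq0
    · rw [← hq0]
      simp only [mul_zero, min_eq_right hp, zero_add, min_eq_left (mul_nonneg hb0.le hp)]
      positivity
    · refine (h _ _ (lt_min hi (by positivity)) (lt_min hq0 (by positivity)) ?_ ?_).trans
        (mul_le_mul (Real.rpow_le_rpow (by positivity) (min_le_left _ _) hα₀)
          (Real.rpow_le_rpow (by positivity) (min_le_left _ _) (by linarith))
          (by positivity) (by positivity))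
      · rw [mul_min_of_nonneg _ _ hb0.le]
        refine le_min (min_le_right _ _) ((min_le_left _ _).trans ?_)
        nlinarith [mul_nonneg (sub_nonneg.mpr hb) hp, mul_nonneg (sub_nonneg.mpr hb)
          (mul_nonneg hb0.le hp)]
      · rw [mul_min_of_nonneg _ _ hb0.le]
        refine le_min (min_le_right _ _) ((min_le_left _ _).trans ?_)
        nlinarith [mul_nonneg (sub_nonneg.mpr hb) hq, mul_nonneg (sub_nonneg.mpr hb)
          (mul_nonneg hb0.le hq)]
  · have hp0 : P i = 0 := le_antisymm (not_lt.mp hi) hp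
    simp [hp0, mul_nonneg hb0.le hq, hq]

theorem sum_rpow_mul_rpow_le (hb : 1 ≤ b) (hα₁ : 1 < α)
    (hP₀ : ∀ i, 0 ≤ P i) (hP : ∑ i, P i = 1) (hQ : ∑ i, Q i = 1)
    (hPQ : ∀ i, P i ≤ b * Q i) (hQP : ∀ i, Q i ≤ b * P i) :
    (∑ i, if 0 < P i then P i ^ α * Q i ^ (1 - α) else 0) ≤ (b ^ α + b ^ (1 - α)) / (1 + b) := by
  obtain ⟨A, B, hAB, h⟩ := exists_rpow_mul_rpow_le_linear hb hα₁
  calc _ ≤ ∑ i, (A * P i + B * Q i) := Finset.sum_le_sum fun i _ => ?_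
    _ = _ := by rw [Finset.sum_add_distrib, ← Finset.mul_sum, ← Finset.mul_sum, hP, hQ, ← hAB]; ring
  have hp := hP₀ i
  split_ifs with hi
  · exact h _ _ hi (pos_of_mul_pos_right (hi.trans_le (hPQ i)) (by linarith)) (hPQ i) (hQP i)
  · have hp0 : P i = 0 := le_antisymm (not_lt.mp hi) hp
    have h₁ := hPQ i
    have h₂ := hQP i
    rw [hp0] at h₁ h₂
    have hq0 : Q i = 0 := le_antisymm (by linarith) (nonneg_of_mul_nonneg_right h₁ (by linarith))
    simp [hp0, hq0]

/-- A negative power of `0` is `∞` in `ℝ≥0∞` but `0` in `ℝ`; the alternative `h` excludes this case.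
-/
theorem sum_ofReal_rpow_mul_rpow (hQ₀ : ∀ i, 0 ≤ Q i)
    (h : α < 1 ∨ ∀ i, 0 < P i → 0 < Q i) :
    (∑ i, if 0 < P i then ENNReal.ofReal (P i) ^ α * ENNReal.ofReal (Q i) ^ (1 - α) else 0)
      = ENNReal.ofReal (∑ i, if 0 < P i then P i ^ α * Q i ^ (1 - α) else 0) := by
  rw [ENNReal.ofReal_sum_of_nonneg]
  · refine Finset.sum_congr rfl fun i _ => ?_
    split_ifs with hi
    · have e : ENNReal.ofReal (Q i) ^ (1 - α) = ENNReal.ofReal (Q i ^ (1 - α)) := by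
        rcases h with h | h
        · exact ENNReal.ofReal_rpow_of_nonneg (hQ₀ i) (by linarith)
        · exact ENNReal.ofReal_rpow_of_pos (h i hi)
      rw [e, ENNReal.ofReal_rpow_of_pos hi, ENNReal.ofReal_mul (by positivity)]
    · simp
  · intro i _
    have := hQ₀ i
    split_ifs with hi
    · positivity
    · rfl

end Classical

/-! ### Power sum of the model pair -/

section Weakest

variable {b δ α : ℝ}

theorem sum_weakest_rpow_mul_rpow (hb : 0 < b) (hδ₁ : δ ≤ 1) (h : α < 1 ∨ δ = 0) :
    (∑ i : Fin 4, if 0 < ![δ, (1 - δ) * (b / (1 + b)), (1 - δ) * (1 / (1 + b)), 0] i then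
      ![δ, (1 - δ) * (b / (1 + b)), (1 - δ) * (1 / (1 + b)), 0] i ^ α
        * ![0, (1 - δ) * (1 / (1 + b)), (1 - δ) * (b / (1 + b)), δ] i ^ (1 - α) else 0)
      = (1 - δ) * ((b ^ α + b ^ (1 - α)) / (1 + b)) := by
  let g : ℝ → ℝ → ℝ := fun x y => if 0 < x then x ^ α * y ^ (1 - α) else 0
  change ∑ i : Fin 4, g (![δ, (1 - δ) * (b / (1 + b)), (1 - δ) * (1 / (1 + b)), 0] i)
    (![0, (1 - δ) * (1 / (1 + b)), (1 - δ) * (b / (1 + b)), δ] i) = _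
  rw [Fin.sum_univ_four]
  change g δ 0 + g ((1 - δ) * (b / (1 + b))) ((1 - δ) * (1 / (1 + b)))
    + g ((1 - δ) * (1 / (1 + b))) ((1 - δ) * (b / (1 + b))) + g 0 δ = _
  have h0 : g δ 0 = 0 := by
    rcases h with h | h
    · simp [g, Real.zero_rpow (sub_pos.mpr h).ne']
    · simp [g, h]
  have h3 : g 0 δ = 0 := by simp [g]
  rw [h0, h3, zero_add, add_zero]
  rcases hδ₁.eq_or_lt with rfl | hδ₁
  · simp [g]
  have hc : 0 < (1 - δ) * (1 / (1 + b)) := by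
    have := sub_pos.mpr hδ₁
    positivity
  have e : (1 - δ) * (b / (1 + b)) = (1 - δ) * (1 / (1 + b)) * b := by ring
  have e' : (1 - δ) * ((b ^ α + b ^ (1 - α)) / (1 + b))
      = (1 - δ) * (1 / (1 + b)) * b ^ α + (1 - δ) * (1 / (1 + b)) * b ^ (1 - α) := by ring
  rw [e, e']
  generalize (1 - δ) * (1 / (1 + b)) = c at hc
  have hg : ∀ x y, 0 < x → g x y = x ^ α * y ^ (1 - α) := fun x y hx => if_pos hx
  rw [hg _ _ (by positivity), hg _ _ hc, Real.mul_rpow hc.le hb.le, Real.mul_rpow hc.le hb.le,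
    mul_right_comm, rpow_mul_rpow_one_sub_self hc, ← mul_assoc (c ^ α),
    rpow_mul_rpow_one_sub_self hc]

end Weakest

/-! ### Measured Rényi divergence -/

section Measured

variable {n : Type*} [DecidableEq n] {k : ℕ} {M : Fin k → Matrix n n ℂ}

theorem IsPOVM.isTest_sum (hM : IsPOVM M) (S : Finset (Fin k)) : IsTest (∑ i ∈ S, M i) := by
  refine ⟨Matrix.posSemidef_sum S fun i _ => hM.nonneg i, ?_⟩
  rw [← hM.sum_eq_one, ← Finset.sum_add_sum_compl S, add_sub_cancel_left]
  exact Matrix.posSemidef_sum _ fun i _ => hM.nonneg i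

variable [Fintype n]

omit [DecidableEq n] in
theorem trace_sum_mul_re (M : Fin k → Matrix n n ℂ) (S : Finset (Fin k)) (ρ : Matrix n n ℂ) :
    ((∑ i ∈ S, M i) * ρ).trace.re = ∑ i ∈ S, (ρ * M i).trace.re := by
  rw [Matrix.trace_mul_comm, Finset.mul_sum, Matrix.trace_sum, Complex.re_sum]

theorem IsPOVM.sum_trace_mul_re (hM : IsPOVM M) {ρ : Matrix n n ℂ} (hρ : IsDensity ρ) :
    ∑ i, (ρ * M i).trace.re = 1 := by
  rw [← trace_sum_mul_re, hM.sum_eq_one, one_mul, hρ.trace_eq_one, Complex.one_re]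

theorem IsDP.sum_trace_le {ε δ : ℝ} {ρ σ : Matrix n n ℂ} (h : IsDP ε δ ρ σ) (hM : IsPOVM M)
    (S : Finset (Fin k)) :
    ∑ i ∈ S, (ρ * M i).trace.re ≤ Real.exp ε * ∑ i ∈ S, (σ * M i).trace.re + δ := by
  have := h.left_le _ (hM.isTest_sum S)
  rwa [trace_sum_mul_re, trace_sum_mul_re] at this

theorem isPOVM_diagonal_single (k : ℕ) :
    IsPOVM fun i : Fin k => Matrix.diagonal fun j => (((Pi.single i 1 : Fin k → ℝ) j : ℝ) : ℂ) := by
  refine ⟨fun i => (isTest_diagonal (fun j => ?_) fun j => ?_).nonneg, ?_⟩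
  · by_cases h : j = i <;> simp [h]
  · by_cases h : j = i <;> simp [h]
  · ext i j
    rw [Matrix.sum_apply, Matrix.one_apply]
    by_cases h : i = j
    · subst h
      simp only [Matrix.diagonal_apply_eq, if_true, ← Complex.ofReal_sum, Pi.single_apply,
        Finset.sum_ite_eq, Finset.mem_univ, Complex.ofReal_one]
    · simp [h]

/-- Measuring in the diagonal basis recovers the distributions. This direction is enough, because
the model pair only needs a lower bound. -/
theorem classicalRenyi_le_measuredRenyi_diagonal (α : ℝ) (P Q : Fin k → ℝ) :
    classicalRenyi α P Q ≤ measuredRenyi α (Matrix.diagonal fun i => ((P i : ℝ) : ℂ))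
      (Matrix.diagonal fun i => ((Q i : ℝ) : ℂ)) := by
  refine le_trans (le_of_eq ?_) (le_iSup_of_le k (le_iSup_of_le _ (le_iSup_of_le
    (isPOVM_diagonal_single k) le_rfl)))
  simp only [trace_diagonal_mul_diagonal_re]
  simp [Pi.single_apply]

theorem measuredRenyi_le_weakest {ε δ : ℝ} (hε : 0 ≤ ε) (hδ₀ : 0 ≤ δ) (hδ₁ : δ ≤ 1)
    {ρ σ : Matrix n n ℂ} (h : IsDP ε δ ρ σ) {α : ℝ} (hα₀ : 0 ≤ α) (hα₁ : α ≠ 1) :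
    measuredRenyi α ρ σ ≤ measuredRenyi α (weakestRho ε δ) (weakestSigma ε δ) := by
  refine iSup_le fun k => iSup_le fun M => iSup_le fun hM => ?_
  have hw := classicalRenyi_le_measuredRenyi_diagonal α
    ![δ, (1 - δ) * (Real.exp ε / (1 + Real.exp ε)), (1 - δ) * (1 / (1 + Real.exp ε)), 0]
    ![0, (1 - δ) * (1 / (1 + Real.exp ε)), (1 - δ) * (Real.exp ε / (1 + Real.exp ε)), δ]
  refine le_trans ?_ hw
  have hb := Real.one_le_exp hε
  have hP₀ : ∀ i, 0 ≤ (ρ * M i).trace.re := fun i =>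
    trace_mul_re_nonneg h.left_density.posSemidef (hM.nonneg i)
  have hQ₀ : ∀ i, 0 ≤ (σ * M i).trace.re := fun i =>
    trace_mul_re_nonneg h.right_density.posSemidef (hM.nonneg i)
  have hwQ₀ : ∀ i, 0 ≤ ![0, (1 - δ) * (1 / (1 + Real.exp ε)),
      (1 - δ) * (Real.exp ε / (1 + Real.exp ε)), δ] i := by
    have := sub_nonneg.mpr hδ₁
    intro i
    fin_cases i <;> simp <;> positivity
  have hPQ := h.sum_trace_le hM
  have hQP := h.symm.sum_trace_le hM
  have hP := hM.sum_trace_mul_re h.left_density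
  have hQ := hM.sum_trace_mul_re h.right_density
  unfold classicalRenyi
  rcases lt_or_gt_of_ne hα₁ with hα₁ | hα₁
  · refine ereal_mul_le_mul_of_nonpos_left (ENNReal.log_le_log ?_)
      (EReal.coe_nonpos.mpr (inv_nonpos.mpr (by linarith)))
    rw [sum_ofReal_rpow_mul_rpow hwQ₀ (.inl hα₁), sum_ofReal_rpow_mul_rpow hQ₀ (.inl hα₁),
      sum_weakest_rpow_mul_rpow (by linarith) hδ₁ (.inl hα₁)]
    exact ENNReal.ofReal_le_ofReal (le_sum_rpow_mul_rpow hb hα₀ hα₁ hP₀ hQ₀ hP hQ hPQ hQP)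
  have hα' : 0 < (α - 1)⁻¹ := inv_pos.mpr (sub_pos.mpr hα₁)
  refine mul_le_mul_of_nonneg_left (ENNReal.log_le_log ?_) (EReal.coe_nonneg.mpr hα'.le)
  rcases hδ₀.eq_or_lt with rfl | hδ₀
  · have hPQ' : ∀ i, (ρ * M i).trace.re ≤ Real.exp ε * (σ * M i).trace.re := fun i => by
      simpa using hPQ {i}
    have hQP' : ∀ i, (σ * M i).trace.re ≤ Real.exp ε * (ρ * M i).trace.re := fun i => by
      simpa using hQP {i}
    rw [sum_ofReal_rpow_mul_rpow hwQ₀ (.inr ?_), sum_ofReal_rpow_mul_rpow hQ₀ (.inr ?_),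
      sum_weakest_rpow_mul_rpow (by linarith) hδ₁ (.inr rfl), sub_zero, one_mul]
    · exact ENNReal.ofReal_le_ofReal (sum_rpow_mul_rpow_le hb hα₁ hP₀ hP hQ hPQ' hQP')
    · exact fun i hi => pos_of_mul_pos_right (hi.trans_le (hPQ' i)) (by linarith)
    · intro i hi
      fin_cases i
      · exact absurd hi (lt_irrefl _)
      · simp; positivity
      · simp; positivity
      · exact absurd hi (lt_irrefl _)
  -- The first outcome has probability `δ > 0` under `ρ` and `0` under `σ`, so the sum is infinite.
  · refine le_trans le_top (le_of_eq (Eq.symm ?_))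
    rw [Fin.sum_univ_four]
    simp [hδ₀, ENNReal.zero_rpow_of_neg (sub_neg.mpr hα₁), ENNReal.mul_top,
      ENNReal.ofReal_rpow_of_pos hδ₀, Real.rpow_pos_of_pos hδ₀]

end Measured

/-! ### Discrete integration and logarithm estimates -/

section RealInequalities

/-- A function on `[0, 1]` whose increments are at most quadratic in the step is antitone. -/
theorem le_of_sub_le_const_mul_sq {g : ℝ → ℝ} {C : ℝ}
    (h : ∀ t s : ℝ, 0 ≤ t → t ≤ s → s ≤ 1 → g s - g t ≤ C * (s - t) ^ 2) {t s : ℝ} (ht : 0 ≤ t)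
    (hts : t ≤ s) (hs : s ≤ 1) : g s ≤ g t := by
  -- With `N` equal steps the quadratic errors add up to `C (s - t)² / N`, which tends to zero.
  have key : ∀ N : ℕ, 0 < N → g s ≤ g t + C * (s - t) ^ 2 / N := by
    intro N hN
    have hN' : (0 : ℝ) < N := by exact_mod_cast hN
    have hd : 0 ≤ (s - t) / N := div_nonneg (sub_nonneg.mpr hts) hN'.le
    have hstep : ∀ k : ℕ, k ≤ N →
        g (t + k * ((s - t) / N)) ≤ g t + k * (C * ((s - t) / N) ^ 2) := by
      intro k
      induction k with
      | zero => intro _; simp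
      | succ k ih =>
        intro hk
        have hk' : (k : ℝ) + 1 ≤ N := by exact_mod_cast hk
        have h₁ : (k + 1) * ((s - t) / N) ≤ s - t := by
          calc (k + 1) * ((s - t) / N) ≤ N * ((s - t) / N) := mul_le_mul_of_nonneg_right hk' hd
            _ = s - t := by field_simp
        have h₂ := h (t + k * ((s - t) / N)) (t + (k + 1) * ((s - t) / N)) (by positivity)
          (by nlinarith) (by linarith)
        have e : t + (k + 1) * ((s - t) / N) - (t + k * ((s - t) / N)) = (s - t) / N := by ring
        rw [e] at h₂
        push_cast
        linarith [ih (by omega)]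
    have hlast := hstep N le_rfl
    have e₁ : t + N * ((s - t) / N) = s := by field_simp; ring
    have e₂ : (N : ℝ) * (C * ((s - t) / N) ^ 2) = C * (s - t) ^ 2 / N := by field_simp
    rwa [e₁, e₂] at hlast
  have hlim : Filter.Tendsto (fun N : ℕ => g t + C * (s - t) ^ 2 / N) Filter.atTop
      (nhds (g t + 0)) :=
    tendsto_const_nhds.add (tendsto_const_div_atTop_nhds_zero_nat _)
  rw [add_zero] at hlim
  exact ge_of_tendsto hlim
    ((Filter.eventually_gt_atTop 0).mono fun N hN => key N hN)

/-- This is `u ≤ sinh u` at `u = log r`. -/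
theorem two_mul_log_le_sub_inv {r : ℝ} (hr : 1 ≤ r) : 2 * Real.log r ≤ r - r⁻¹ := by
  have h := Real.self_le_sinh_iff.mpr (Real.log_nonneg hr)
  rw [Real.sinh_eq, Real.exp_neg, Real.exp_log (by linarith)] at h
  linarith

theorem two_mul_sub_mul_log_sub_log_le {a b : ℝ} (ha : 0 < a) (hb : 0 < b) :
    2 * ((a - b) * (Real.log a - Real.log b)) ≤ (a - b) ^ 2 * (a⁻¹ + b⁻¹) := by
  wlog hab : b ≤ a generalizing a b
  · have := this hb ha (le_of_not_ge hab)
    nlinarith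
  have h := two_mul_log_le_sub_inv ((one_le_div hb).mpr hab)
  rw [Real.log_div ha.ne' hb.ne', inv_div] at h
  have h' := mul_le_mul_of_nonneg_left h (sub_nonneg.mpr hab)
  have e : (a - b) * (a / b - b / a) = (a - b) ^ 2 * (a⁻¹ + b⁻¹) := by
    field_simp
    ring
  linarith

theorem one_sub_div_le_log_sub_log {w z : ℝ} (hw : 0 < w) (hz : 0 < z) :
    (z - w) / z ≤ Real.log z - Real.log w := by
  have h := Real.one_sub_inv_le_log_of_pos (div_pos hz hw)
  rw [Real.log_div hz.ne' hw.ne', inv_div] at h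
  rwa [sub_div, div_self hz.ne']

/-- The difference of logarithms lies between `(z - w) / z` and `(z - w) / w`; the trapezoid value
is their midpoint and the bound is half the gap. -/
theorem abs_trapezoid_sub_log_le {w z : ℝ} (hw : 0 < w) (hz : 0 < z) :
    |(z - w) * (w⁻¹ + z⁻¹) / 2 - (Real.log z - Real.log w)| ≤ (z - w) ^ 2 / (w * z) / 2 := by
  have h₁ := one_sub_div_le_log_sub_log hw hz
  have h₂ := one_sub_div_le_log_sub_log hz hw
  have e₁ : (z - w) * (w⁻¹ + z⁻¹) / 2 = (z - w) / z + (z - w) ^ 2 / (w * z) / 2 := by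
    field_simp
    ring
  have e₂ : (z - w) * (w⁻¹ + z⁻¹) / 2 = -((w - z) / w) - (z - w) ^ 2 / (w * z) / 2 := by
    field_simp
    ring
  rw [abs_le]
  constructor <;> linarith

end RealInequalities

/-! ### Trace inequalities from joint spectral distributions -/

section FunctionalCalculus

variable {n : Type*} [Fintype n] [DecidableEq n] {A B : Matrix n n ℂ}

theorem continuousOn_real_spectrum (f : ℝ → ℝ) (A : Matrix n n ℂ) :
    ContinuousOn f (spectrum ℝ A) :=
  Matrix.finite_real_spectrum.continuousOn f

theorem cfc_mul_cfc (f g : ℝ → ℝ) (A : Matrix n n ℂ) :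
    cfc f A * cfc g A = cfc (fun x => f x * g x) A :=
  (cfc_mul f g A (continuousOn_real_spectrum f A) (continuousOn_real_spectrum g A)).symm

theorem mul_cfc (hA : A.IsHermitian) (g : ℝ → ℝ) : A * cfc g A = cfc (fun x => x * g x) A := by
  have := cfc_mul_cfc id g A
  rwa [cfc_id ℝ A hA.isSelfAdjoint] at this

theorem cfc_mul_self (hA : A.IsHermitian) (g : ℝ → ℝ) :
    cfc g A * A = cfc (fun x => g x * x) A := by
  have := cfc_mul_cfc g id A
  rwa [cfc_id ℝ A hA.isSelfAdjoint] at this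

/-- The joint spectral distribution of two Hermitian matrices. -/
theorem exists_trace_cfc_mul_cfc (hA : A.IsHermitian) (hB : B.IsHermitian) :
    ∃ c : n → n → ℝ, (∀ i j, 0 ≤ c i j) ∧ ∀ f g : ℝ → ℝ,
      (cfc f A * cfc g B).trace.re
        = ∑ i, ∑ j, c i j * (f (hA.eigenvalues i) * g (hB.eigenvalues j)) := by
  -- Overlaps of the two eigenbases; their squared moduli are the joint weights.
  let W : Matrix n n ℂ := star (hA.eigenvectorUnitary : Matrix n n ℂ) * hB.eigenvectorUnitary
  refine ⟨fun i j => Complex.normSq (W i j), fun i j => Complex.normSq_nonneg _, fun f g => ?_⟩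
  rw [hA.cfc_eq, hB.cfc_eq, Matrix.IsHermitian.cfc, Matrix.IsHermitian.cfc,
    Unitary.conjStarAlgAut_apply, Unitary.conjStarAlgAut_apply]
  have e : ∀ U V D E : Matrix n n ℂ, (U * D * star U * (V * E * star V)).trace
      = (D * (star U * V) * E * star (star U * V)).trace := by
    intro U V D E
    rw [star_mul, star_star]
    simp only [Matrix.mul_assoc]
    rw [Matrix.trace_mul_comm]
    simp only [Matrix.mul_assoc]
  rw [e]
  change (_ * W * _ * star W).trace.re = _
  rw [Matrix.trace, Complex.re_sum]
  refine Finset.sum_congr rfl fun i _ => ?_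
  rw [Matrix.diag_apply, Matrix.mul_apply, Complex.re_sum]
  refine Finset.sum_congr rfl fun j _ => ?_
  rw [Matrix.mul_diagonal, Matrix.diagonal_mul, Matrix.star_apply]
  simp only [Function.comp_apply]
  have : (RCLike.ofReal (f (hA.eigenvalues i)) : ℂ) * W i j
      * (RCLike.ofReal (g (hB.eigenvalues j)) : ℂ) * star (W i j)
      = ((Complex.normSq (W i j) * (f (hA.eigenvalues i) * g (hB.eigenvalues j)) : ℝ) : ℂ) := by
    push_cast
    rw [← Complex.mul_conj]
    simp only [RCLike.star_def, Complex.coe_algebraMap]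
    ring
  rw [this, Complex.ofReal_re]

theorem mul_eq_zero_of_ker_le (h : ∀ v : n → ℂ, B *ᵥ v = 0 → A *ᵥ v = 0) {C : Matrix n n ℂ}
    (hC : B * C = 0) : A * C = 0 := by
  refine Matrix.ext_of_mulVec_single fun j => ?_
  rw [← Matrix.mulVec_mulVec, Matrix.zero_mulVec]
  apply h
  rw [Matrix.mulVec_mulVec, hC, Matrix.zero_mulVec]

theorem mul_cfc_indicator_zero (hA : A.IsHermitian) :
    A * cfc (fun x : ℝ => if x = 0 then (1 : ℝ) else 0) A = 0 := by
  rw [mul_cfc hA]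
  have : (fun x : ℝ => x * if x = 0 then (1 : ℝ) else 0) = fun _ => 0 := by
    ext x
    split_ifs with h <;> simp [h]
  rw [this, cfc_const_zero]

/-- The joint spectral distribution of two positive semidefinite matrices with the same kernel. -/
theorem exists_trace_cfc_mul_cfc_of_ker_eq (hA : A.PosSemidef) (hB : B.PosSemidef)
    (h : ∀ v : n → ℂ, A *ᵥ v = 0 ↔ B *ᵥ v = 0) :
    ∃ (c : n → n → ℝ) (a b : n → ℝ), (∀ i j, 0 ≤ c i j) ∧ (∀ i, 0 ≤ a i) ∧ (∀ j, 0 ≤ b j) ∧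
      (∀ i j, c i j = 0 ∨ (a i = 0 ∧ b j = 0) ∨ (0 < a i ∧ 0 < b j)) ∧ ∀ f g : ℝ → ℝ,
      (cfc f A * cfc g B).trace.re = ∑ i, ∑ j, c i j * (f (a i) * g (b j)) := by
  obtain ⟨c, hc, hF⟩ := exists_trace_cfc_mul_cfc hA.1 hB.1
  refine ⟨c, _, _, hc, hA.eigenvalues_nonneg, hB.eigenvalues_nonneg, fun i j => ?_, hF⟩
  have ha := hA.eigenvalues_nonneg
  have hb := hB.eigenvalues_nonneg
  -- Equal kernels make the trace of one matrix against the other's kernel projection vanish. As a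
  -- sum of nonnegative terms it vanishes termwise, so no weight joins a zero eigenvalue to a
  -- positive one.
  have h₁ := hF id fun x => if x = 0 then 1 else 0
  have h₂ := hF (fun x => if x = 0 then 1 else 0) id
  rw [cfc_id ℝ A hA.1.isSelfAdjoint, mul_eq_zero_of_ker_le (fun v => (h v).mpr)
    (mul_cfc_indicator_zero hB.1), Matrix.trace_zero, Complex.zero_re] at h₁
  rw [cfc_id ℝ B hB.1.isSelfAdjoint, Matrix.trace_mul_comm, mul_eq_zero_of_ker_le
    (fun v => (h v).mp) (mul_cfc_indicator_zero hA.1), Matrix.trace_zero, Complex.zero_re] at h₂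
  have k₁ : c i j * (id (hA.1.eigenvalues i) * if hB.1.eigenvalues j = 0 then 1 else 0) = 0 := by
    have hnn : ∀ i j,
        0 ≤ c i j * (id (hA.1.eigenvalues i) * if hB.1.eigenvalues j = 0 then 1 else 0) :=
      fun i j => mul_nonneg (hc i j) (mul_nonneg (ha i) (by split_ifs <;> norm_num))
    have := (Finset.sum_eq_zero_iff_of_nonneg fun i _ =>
      Finset.sum_nonneg fun j _ => hnn i j).mp h₁.symm i (Finset.mem_univ i)
    exact (Finset.sum_eq_zero_iff_of_nonneg fun j _ => hnn i j).mp this j (Finset.mem_univ j)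
  have k₂ : c i j * ((if hA.1.eigenvalues i = 0 then 1 else 0) * id (hB.1.eigenvalues j)) = 0 := by
    have hnn : ∀ i j,
        0 ≤ c i j * ((if hA.1.eigenvalues i = 0 then 1 else 0) * id (hB.1.eigenvalues j)) :=
      fun i j => mul_nonneg (hc i j) (mul_nonneg (by split_ifs <;> norm_num) (hb j))
    have := (Finset.sum_eq_zero_iff_of_nonneg fun i _ =>
      Finset.sum_nonneg fun j _ => hnn i j).mp h₂.symm i (Finset.mem_univ i)
    exact (Finset.sum_eq_zero_iff_of_nonneg fun j _ => hnn i j).mp this j (Finset.mem_univ j)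
  rcases (ha i).eq_or_lt with hi | hi <;> rcases (hb j).eq_or_lt with hj | hj
  · exact .inr (.inl ⟨hi.symm, hj.symm⟩)
  · rw [if_pos hi.symm, one_mul] at k₂
    exact .inl ((mul_eq_zero.mp k₂).resolve_right hj.ne')
  · rw [if_pos hj.symm, mul_one] at k₁
    exact .inl ((mul_eq_zero.mp k₁).resolve_right hi.ne')
  · exact .inr (.inr ⟨hi, hj⟩)

/-- Convexity of `A ↦ Tr[A log A]`, to first order. -/
theorem trace_mul_log_sub_le (hA : A.PosSemidef) (hB : B.PosSemidef)
    (h : ∀ v : n → ℂ, A *ᵥ v = 0 ↔ B *ᵥ v = 0) (htr : A.trace = B.trace) :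
    (A * cfc Real.log A).trace.re - (B * cfc Real.log B).trace.re
      ≤ ((A - B) * cfc Real.log A).trace.re := by
  obtain ⟨c, a, b, hc, -, -, hab, hF⟩ := exists_trace_cfc_mul_cfc_of_ker_eq hA hB h
  have e₁ := hF Real.log id
  have e₂ := hF (fun _ => 1) fun x => x * Real.log x
  have e₃ := hF id fun _ => 1
  have e₄ := hF (fun _ => 1) id
  rw [cfc_id ℝ B hB.1.isSelfAdjoint, Matrix.trace_mul_comm] at e₁
  rw [cfc_const_one ℝ A hA.1.isSelfAdjoint, one_mul, ← mul_cfc hB.1] at e₂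
  rw [cfc_const_one ℝ B hB.1.isSelfAdjoint, mul_one, cfc_id ℝ A hA.1.isSelfAdjoint] at e₃
  rw [cfc_const_one ℝ A hA.1.isSelfAdjoint, one_mul, cfc_id ℝ B hB.1.isSelfAdjoint] at e₄
  rw [sub_mul, Matrix.trace_sub, Complex.sub_re]
  -- What remains is Klein's inequality, which holds termwise as `b log a - b log b ≤ a - b`.
  suffices (B * cfc Real.log A).trace.re - (B * cfc Real.log B).trace.re
      ≤ A.trace.re - B.trace.re by
    rw [htr, sub_self] at this
    linarith
  rw [e₁, e₂, e₃, e₄]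
  simp only [← Finset.sum_sub_distrib]
  refine Finset.sum_le_sum fun i _ => Finset.sum_le_sum fun j _ => ?_
  rw [← mul_sub, ← mul_sub]
  rcases hab i j with h0 | ⟨hi, hj⟩ | ⟨hi, hj⟩
  · simp [h0]
  · simp [hi, hj]
  · refine mul_le_mul_of_nonneg_left ?_ (hc i j)
    have := mul_le_mul_of_nonneg_left (one_sub_div_le_log_sub_log hi hj) hj.le
    rw [mul_div_cancel₀ _ hj.ne'] at this
    simp only [id]
    linarith

/-- The symmetrised relative entropy is at most the mean of the two `χ²`-divergences; inverses are
taken on the support. -/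
theorem two_mul_trace_sub_mul_log_sub_log_le (hA : A.PosSemidef) (hB : B.PosSemidef)
    (h : ∀ v : n → ℂ, A *ᵥ v = 0 ↔ B *ᵥ v = 0) :
    2 * ((A - B) * (cfc Real.log A - cfc Real.log B)).trace.re
      ≤ (cfc (fun x : ℝ => x⁻¹) A * ((A - B) * (A - B))).trace.re
        + (cfc (fun x : ℝ => x⁻¹) B * ((A - B) * (A - B))).trace.re := by
  obtain ⟨c, a, b, hc, -, -, hab, hF⟩ := exists_trace_cfc_mul_cfc_of_ker_eq hA hB h
  have hA1 := cfc_const_one ℝ A hA.1.isSelfAdjoint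
  have hB1 := cfc_const_one ℝ B hB.1.isSelfAdjoint
  have hAi := cfc_id ℝ A hA.1.isSelfAdjoint
  have hBi := cfc_id ℝ B hB.1.isSelfAdjoint
  have l₁ := hF (fun x => x * Real.log x) fun _ => 1
  have l₂ := hF id Real.log
  have l₃ := hF Real.log id
  have l₄ := hF (fun _ => 1) fun x => x * Real.log x
  rw [hB1, mul_one, ← mul_cfc hA.1] at l₁
  rw [hAi] at l₂
  rw [hBi, Matrix.trace_mul_comm] at l₃
  rw [hA1, one_mul, ← mul_cfc hB.1] at l₄
  -- Every monomial in the expanded traces becomes a double sum over the same weights, so a scalar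
  -- inequality suffices. The products `x * x⁻¹` are `0` at `x = 0`, giving support projections.
  have p₁ := hF (fun x => x * (x * x⁻¹)) fun _ => 1
  have p₂ := hF (fun x => x * x⁻¹) id
  have p₄ := hF (fun x => x⁻¹) fun x => x * id x
  rw [hB1, mul_one, ← mul_cfc hA.1, ← mul_cfc hA.1] at p₁
  rw [hBi, ← mul_cfc hA.1] at p₂
  rw [← mul_cfc hB.1, hBi] at p₄
  have q₁ := hF (fun x => x * id x) fun x => x⁻¹
  have q₂ := hF id fun x => x * x⁻¹
  have q₄ := hF (fun _ => 1) fun x => x * (x * x⁻¹)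
  rw [← mul_cfc hA.1, hAi] at q₁
  rw [hAi, ← mul_cfc hB.1] at q₂
  rw [hA1, one_mul, ← mul_cfc hB.1, ← mul_cfc hB.1] at q₄
  have cA : cfc (fun x : ℝ => x⁻¹) A * A = A * cfc (fun x : ℝ => x⁻¹) A := by
    rw [mul_cfc hA.1, cfc_mul_self hA.1]
    simp only [mul_comm]
  have cB : cfc (fun x : ℝ => x⁻¹) B * B = B * cfc (fun x : ℝ => x⁻¹) B := by
    rw [mul_cfc hB.1, cfc_mul_self hB.1]
    simp only [mul_comm]
  have eL : ((A - B) * (cfc Real.log A - cfc Real.log B)).trace.re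
      = (A * cfc Real.log A).trace.re - (A * cfc Real.log B).trace.re
        - (B * cfc Real.log A).trace.re + (B * cfc Real.log B).trace.re := by
    simp only [sub_mul, mul_sub, Matrix.trace_sub, Complex.sub_re]
    ring
  have eA : (cfc (fun x : ℝ => x⁻¹) A * ((A - B) * (A - B))).trace.re
      = (A * (A * cfc (fun x : ℝ => x⁻¹) A)).trace.re
        - 2 * (A * cfc (fun x : ℝ => x⁻¹) A * B).trace.re
        + (cfc (fun x : ℝ => x⁻¹) A * (B * B)).trace.re := by
    generalize cfc (fun x : ℝ => x⁻¹) A = I at cA ⊢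
    have t₁ : (I * (A * A)).trace = (A * (A * I)).trace := by
      rw [Matrix.trace_mul_comm, Matrix.mul_assoc]
    have t₂ : (I * (A * B)).trace = (A * I * B).trace := by
      rw [← Matrix.mul_assoc, cA]
    have t₃ : (I * (B * A)).trace = (A * I * B).trace := by
      rw [Matrix.trace_mul_comm, Matrix.mul_assoc, Matrix.trace_mul_comm]
    simp only [sub_mul, mul_sub, Matrix.trace_sub, Complex.sub_re, t₁, t₂, t₃]
    ring
  have eB : (cfc (fun x : ℝ => x⁻¹) B * ((A - B) * (A - B))).trace.re
      = (A * A * cfc (fun x : ℝ => x⁻¹) B).trace.re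
        - 2 * (A * (B * cfc (fun x : ℝ => x⁻¹) B)).trace.re
        + (B * (B * cfc (fun x : ℝ => x⁻¹) B)).trace.re := by
    generalize cfc (fun x : ℝ => x⁻¹) B = I at cB ⊢
    have t₁ : (I * (A * A)).trace = (A * A * I).trace := Matrix.trace_mul_comm _ _
    have t₂ : (I * (A * B)).trace = (A * (B * I)).trace := by
      rw [Matrix.trace_mul_comm, Matrix.mul_assoc]
    have t₃ : (I * (B * A)).trace = (A * (B * I)).trace := by
      rw [← Matrix.mul_assoc, cB, Matrix.trace_mul_comm]
    have t₄ : (I * (B * B)).trace = (B * (B * I)).trace := by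
      rw [Matrix.trace_mul_comm, Matrix.mul_assoc]
    simp only [sub_mul, mul_sub, Matrix.trace_sub, Complex.sub_re, t₁, t₂, t₃, t₄]
    ring
  rw [eL, eA, eB, l₁, l₂, l₃, l₄, p₁, p₂, p₄, q₁, q₂, q₄]
  simp only [Finset.mul_sum, ← Finset.sum_sub_distrib, ← Finset.sum_add_distrib]
  refine Finset.sum_le_sum fun i _ => Finset.sum_le_sum fun j _ => ?_
  rcases hab i j with h0 | ⟨hi, hj⟩ | ⟨hi, hj⟩
  · simp [h0]
  · simp [hi, hj]
  · have key := mul_le_mul_of_nonneg_left (two_mul_sub_mul_log_sub_log_le hi hj) (hc i j)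
    have e₁ := mul_inv_cancel₀ hi.ne'
    have e₂ := mul_inv_cancel₀ hj.ne'
    simp only [id, e₁, e₂]
    have e : (a i - b j) ^ 2 * ((a i)⁻¹ + (b j)⁻¹)
        = a i - b j - b j + (a i)⁻¹ * (b j * b j) + (a i * a i * (b j)⁻¹ - a i - a i + b j) := by
      field_simp
      ring
    rw [e] at key
    linarith

theorem cfc_diagonal (d : n → ℝ) (f : ℝ → ℝ) :
    cfc f (Matrix.diagonal fun i => ((d i : ℝ) : ℂ))
      = Matrix.diagonal fun i => ((f (d i) : ℝ) : ℂ) := by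
  set D : Matrix n n ℂ := Matrix.diagonal fun i => ((d i : ℝ) : ℂ) with hD
  have hDh : D.IsHermitian := by
    rw [hD, Matrix.isHermitian_diagonal_iff]
    intro i
    simp [IsSelfAdjoint]
  -- Interpolating on both the entries and the spectrum avoids having to identify the two sets.
  let S : Finset ℝ := (Finset.univ.image d) ∪ Matrix.finite_real_spectrum (A := D).toFinset
  let p : Polynomial ℝ := Lagrange.interpolate S id f
  have hp : ∀ x ∈ S, p.eval x = f x := fun x hx =>
    Lagrange.eval_interpolate_at_node (v := id) f Function.injective_id.injOn hx
  have h₁ : cfc f D = cfc (fun x => p.eval x) D :=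
    cfc_congr fun x hx => (hp x (Finset.mem_union_right _ (by simpa using hx))).symm
  rw [h₁, cfc_polynomial p D hDh.isSelfAdjoint, hD]
  change Polynomial.aeval (Matrix.diagonalAlgHom ℝ fun i => ((d i : ℝ) : ℂ)) p = _
  rw [Polynomial.aeval_algHom_apply]
  change Matrix.diagonal _ = _
  congr 1
  ext i
  have h₂ := Polynomial.aeval_algHom_apply (Pi.evalAlgHom ℝ (fun _ : n => ℂ) i)
    (fun i => ((d i : ℝ) : ℂ)) p
  change Polynomial.aeval ((d i : ℝ) : ℂ) p = _ at h₂
  change (Pi.evalAlgHom ℝ (fun _ : n => ℂ) i) _ = _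
  refine h₂.symm.trans ?_
  rw [← hp (d i) (Finset.mem_union_left _ (Finset.mem_image_of_mem d (Finset.mem_univ i)))]
  exact Polynomial.aeval_algebraMap_apply_eq_algebraMap_eval (d i) p

end FunctionalCalculus

/-! ### Relative entropy along a segment -/

section Segment

variable {n : Type*} [Fintype n] {X Y : Matrix n n ℂ}

theorem mulVec_smul_add_smul_eq_zero_iff (hX : X.PosSemidef) (hY : Y.PosSemidef) {v u : ℝ}
    (hv : 0 < v) (hu : 0 < u) (z : n → ℂ) :
    (v • X + u • Y) *ᵥ z = 0 ↔ X *ᵥ z = 0 ∧ Y *ᵥ z = 0 := by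
  constructor
  · intro h
    have h₁ := hX.dotProduct_mulVec_nonneg z
    have h₂ := hY.dotProduct_mulVec_nonneg z
    have h₃ : v • (star z ⬝ᵥ X *ᵥ z) + u • (star z ⬝ᵥ Y *ᵥ z) = 0 := by
      rw [← dotProduct_smul, ← dotProduct_smul, ← dotProduct_add, ← Matrix.smul_mulVec,
        ← Matrix.smul_mulVec, ← Matrix.add_mulVec, h, dotProduct_zero]
    have h₄ := (add_eq_zero_iff_of_nonneg (smul_nonneg hv.le h₁) (smul_nonneg hu.le h₂)).mp h₃
    exact ⟨(hX.dotProduct_mulVec_zero_iff z).mp ((smul_eq_zero.mp h₄.1).resolve_left hv.ne'),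
      (hY.dotProduct_mulVec_zero_iff z).mp ((smul_eq_zero.mp h₄.2).resolve_left hu.ne')⟩
  · rintro ⟨h₁, h₂⟩
    rw [Matrix.add_mulVec, Matrix.smul_mulVec, Matrix.smul_mulVec, h₁, h₂, smul_zero, smul_zero,
      add_zero]

theorem trace_conjTranspose_mul_re (A B : Matrix n n ℂ) :
    (Aᴴ * Bᴴ).trace.re = (A * B).trace.re := by
  rw [← Matrix.conjTranspose_mul, Matrix.trace_conjTranspose, Matrix.trace_mul_comm]
  exact Complex.conj_re _

/-- Expand `Tr[(c - M)ᴴ X (c - M)] ≥ 0`. -/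
theorem two_mul_trace_mul_re_le (hX : X.PosSemidef) (c : ℝ) (M : Matrix n n ℂ) :
    2 * (c * (X * M).trace.re) ≤ c ^ 2 * X.trace.re + (Mᴴ * X * M).trace.re := by
  classical
  have h := trace_re_nonneg (hX.conjTranspose_mul_mul_same (c • (1 : Matrix n n ℂ) - M))
  have e : (Mᴴ * X).trace.re = (X * M).trace.re := by
    have := trace_conjTranspose_mul_re M X
    rwa [hX.1.eq, Matrix.trace_mul_comm M] at this
  rw [Matrix.conjTranspose_sub, Matrix.conjTranspose_smul, Matrix.conjTranspose_one,
    star_trivial] at h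
  simp only [sub_mul, mul_sub, smul_mul_assoc, mul_smul_comm, one_mul, mul_one,
    Matrix.trace_sub, Matrix.trace_smul, Complex.sub_re, Complex.smul_re, smul_eq_mul, e] at h
  linarith

omit [Fintype n] in
theorem isHermitian_smul_add_smul (hX : X.IsHermitian) (hY : Y.IsHermitian) (v u : ℝ) :
    (v • X + u • Y).IsHermitian := by
  rw [Matrix.IsHermitian, Matrix.conjTranspose_add, Matrix.conjTranspose_smul,
    Matrix.conjTranspose_smul, hX.eq, hY.eq, star_trivial, star_trivial]

variable [DecidableEq n]

/-- Joint convexity of `(Δ, ω) ↦ Tr[ω⁻¹ Δ²]`. -/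
theorem trace_inv_mul_sq_le (hX : X.PosSemidef) (hY : Y.PosSemidef) {v u : ℝ} (hv : 0 < v)
    (hu : 0 < u) (p q : ℝ) :
    (cfc (fun x : ℝ => x⁻¹) (v • X + u • Y) * ((p • X + q • Y) * (p • X + q • Y))).trace.re
      ≤ p ^ 2 * v⁻¹ * X.trace.re + q ^ 2 * u⁻¹ * Y.trace.re := by
  have hω := isHermitian_smul_add_smul hX.1 hY.1 v u
  have hΔ := isHermitian_smul_add_smul hX.1 hY.1 p q
  have hker := mulVec_smul_add_smul_eq_zero_iff hX hY hv hu
  have hkΔ : ∀ z : n → ℂ, (v • X + u • Y) *ᵥ z = 0 → (p • X + q • Y) *ᵥ z = 0 := by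
    intro z hz
    obtain ⟨h₁, h₂⟩ := (hker z).mp hz
    rw [Matrix.add_mulVec, Matrix.smul_mulVec, Matrix.smul_mulVec, h₁, h₂, smul_zero, smul_zero,
      add_zero]
  obtain ⟨ω, hωe⟩ : ∃ ω, ω = v • X + u • Y := ⟨_, rfl⟩
  obtain ⟨Δ, hΔe⟩ : ∃ Δ, Δ = p • X + q • Y := ⟨_, rfl⟩
  rw [← hωe, ← hΔe] at hkΔ ⊢
  rw [← hωe] at hω
  rw [← hΔe] at hΔ
  have hIω := mul_cfc hω fun x => x⁻¹
  have hIω' := cfc_mul_self hω fun x => x⁻¹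
  have hIωω := mul_cfc hω fun x => x * x⁻¹
  have hI : (cfc (fun x : ℝ => x⁻¹) ω)ᴴ = cfc (fun x : ℝ => x⁻¹) ω :=
    (cfc_predicate (fun x : ℝ => x⁻¹) ω : IsSelfAdjoint _)
  have hsupp : ω * (1 - ω * cfc (fun x : ℝ => x⁻¹) ω) = 0 := by
    rw [mul_sub, mul_one, hIω, hIωω, sub_eq_zero]
    have : (fun x : ℝ => x * (x * x⁻¹)) = id := by
      ext x
      by_cases hx : x = 0 <;> simp [hx]
    rw [this, cfc_id ℝ ω hω.isSelfAdjoint]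
  have hΔω := mul_eq_zero_of_ker_le hkΔ hsupp
  simp only [mul_comm] at hIω hIω'
  have hcomm := hIω.trans hIω'.symm
  generalize cfc (fun x : ℝ => x⁻¹) ω = I at *
  -- The kernel of `ω` lies in that of `Δ`, so the inverse on the support really solves `ω M = Δ`.
  have hM : ω * (I * Δ) = Δ := by
    rw [mul_sub, mul_one, sub_eq_zero, hcomm] at hΔω
    have := congrArg Matrix.conjTranspose hΔω
    rw [Matrix.conjTranspose_mul, Matrix.conjTranspose_mul, hI, hω.eq, hΔ.eq,
      Matrix.mul_assoc] at this
    exact this.symm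
  have hT : (I * (Δ * Δ)).trace.re = (Δ * (I * Δ)).trace.re := by
    rw [← Matrix.mul_assoc, Matrix.trace_mul_comm]
  rw [hT]
  generalize I * Δ = M at *
  -- With `c = p / v` and `c = q / u` the linear terms sum to `2 Tr[ΔM]` and the quadratic ones to
  -- `Tr[Mᴴ ω M] = Tr[ΔM]`, leaving one copy to be bounded.
  have h₁ := mul_le_mul_of_nonneg_left (two_mul_trace_mul_re_le hX (p / v) M) hv.le
  have h₂ := mul_le_mul_of_nonneg_left (two_mul_trace_mul_re_le hY (q / u) M) hu.le
  have e₁ : (Δ * M).trace.re = p * (X * M).trace.re + q * (Y * M).trace.re := by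
    rw [hΔe]
    simp [add_mul]
  have e₂ : (Δ * M).trace.re = v * (Mᴴ * X * M).trace.re + u * (Mᴴ * Y * M).trace.re := by
    have h₃ : (Mᴴ * ω * M).trace.re = (Δ * M).trace.re := by
      rw [Matrix.mul_assoc, hM, Matrix.trace_mul_comm]
      have := trace_conjTranspose_mul_re Δ M
      rwa [hΔ.eq] at this
    rw [← h₃, hωe]
    simp [add_mul, mul_add]
  have e₃ : v * (2 * (p / v * (X * M).trace.re)) = 2 * (p * (X * M).trace.re) := by field_simp
  have e₄ : u * (2 * (q / u * (Y * M).trace.re)) = 2 * (q * (Y * M).trace.re) := by field_simp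
  have e₅ : v * ((p / v) ^ 2 * X.trace.re + (Mᴴ * X * M).trace.re)
      = p ^ 2 * v⁻¹ * X.trace.re + v * (Mᴴ * X * M).trace.re := by field_simp
  have e₆ : u * ((q / u) ^ 2 * Y.trace.re + (Mᴴ * Y * M).trace.re)
      = q ^ 2 * u⁻¹ * Y.trace.re + u * (Mᴴ * Y * M).trace.re := by field_simp
  linarith

theorem mul_trapezoid_sub_log_le {p t s m : ℝ} (hm : 0 < m) (ht : m ≤ 1 + t * p)
    (hs : m ≤ 1 + s * p) :
    p ^ 2 * (s - t) * ((1 + t * p)⁻¹ + (1 + s * p)⁻¹) / 2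
      - p * (Real.log (1 + s * p) - Real.log (1 + t * p)) ≤ |p| ^ 3 / m ^ 2 / 2 * (s - t) ^ 2 := by
  have h := abs_trapezoid_sub_log_le (hm.trans_le ht) (hm.trans_le hs)
  have e : (1 + s * p) - (1 + t * p) = p * (s - t) := by ring
  rw [e] at h
  calc p ^ 2 * (s - t) * ((1 + t * p)⁻¹ + (1 + s * p)⁻¹) / 2
        - p * (Real.log (1 + s * p) - Real.log (1 + t * p))
      = p * (p * (s - t) * ((1 + t * p)⁻¹ + (1 + s * p)⁻¹) / 2
          - (Real.log (1 + s * p) - Real.log (1 + t * p))) := by ring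
    _ ≤ |p| * |p * (s - t) * ((1 + t * p)⁻¹ + (1 + s * p)⁻¹) / 2
          - (Real.log (1 + s * p) - Real.log (1 + t * p))| := by
        rw [← abs_mul]
        exact le_abs_self _
    _ ≤ |p| * ((p * (s - t)) ^ 2 / ((1 + t * p) * (1 + s * p)) / 2) :=
        mul_le_mul_of_nonneg_left h (abs_nonneg p)
    _ ≤ |p| * ((p * (s - t)) ^ 2 / (m * m) / 2) := by
        have := hm.trans_le ht
        gcongr
    _ = |p| ^ 3 / m ^ 2 / 2 * (s - t) ^ 2 := by
        rw [mul_pow, ← sq_abs p]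
        field_simp

/-- The term `-p (s - t)` comes from the constant in the derivative of `u log u`; weighted by the
two traces it cancels, because `p x + q y = 0`. -/
theorem mul_log_sub_mul_log_le {p t s m : ℝ} (hm : 0 < m) (ht : m ≤ 1 + t * p)
    (hs : m ≤ 1 + s * p) :
    (s - t) * (p * Real.log (1 + s * p))
        - ((1 + s * p) * Real.log (1 + s * p) - (1 + t * p) * Real.log (1 + t * p))
      ≤ p ^ 2 / m * (s - t) ^ 2 - p * (s - t) := by
  have ht' := hm.trans_le ht
  have hs' := hm.trans_le hs
  have h := mul_le_mul_of_nonneg_left (one_sub_div_le_log_sub_log ht' hs') ht'.le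
  have e : (1 + t * p) * ((1 + s * p - (1 + t * p)) / (1 + s * p))
      = p * (s - t) - (p * (s - t)) ^ 2 / (1 + s * p) := by
    rw [eq_sub_iff_add_eq, ← mul_div_assoc, ← add_div, div_eq_iff hs'.ne']
    ring
  have e' : (p * (s - t)) ^ 2 / (1 + s * p) ≤ (p * (s - t)) ^ 2 / m := by gcongr
  have e'' : (p * (s - t)) ^ 2 / m = p ^ 2 / m * (s - t) ^ 2 := by ring
  linarith

theorem le_one_add_mul {p t m : ℝ} (hm₁ : m ≤ 1) (hm : m ≤ 1 + p) (ht₀ : 0 ≤ t) (ht₁ : t ≤ 1) :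
    m ≤ 1 + t * p := by
  nlinarith [mul_le_mul_of_nonneg_left hm ht₀, mul_le_mul_of_nonneg_left hm₁ (sub_nonneg.mpr ht₁)]

/-- The relative entropy of the end points of the segment `(1 + t p) X + (1 + t q) Y` is at most
that of the commuting pair with the same weights. -/
theorem trace_mul_log_sub_log_le (hX : X.PosSemidef) (hY : Y.PosSemidef) {p q x y : ℝ}
    (hp : 0 < 1 + p) (hq : 0 < 1 + q) (hx : X.trace = (x : ℂ)) (hy : Y.trace = (y : ℂ))
    (hxy : p * x + q * y = 0) :
    (((1 + p) • X + (1 + q) • Y) * (cfc Real.log ((1 + p) • X + (1 + q) • Y)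
      - cfc Real.log (X + Y))).trace.re
      ≤ x * ((1 + p) * Real.log (1 + p)) + y * ((1 + q) * Real.log (1 + q)) := by
  -- A lower bound for all weights on the segment, making the quadratic error constants uniform.
  obtain ⟨m, hm₀, hm₁, hmp, hmq⟩ : ∃ m : ℝ, 0 < m ∧ m ≤ 1 ∧ m ≤ 1 + p ∧ m ≤ 1 + q :=
    ⟨min 1 (min (1 + p) (1 + q)), by positivity, min_le_left _ _,
      (min_le_right _ _).trans (min_le_left _ _), (min_le_right _ _).trans (min_le_right _ _)⟩
  have hx₀ : 0 ≤ x := by simpa [hx] using trace_re_nonneg hX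
  have hy₀ : 0 ≤ y := by simpa [hy] using trace_re_nonneg hY
  let ω : ℝ → Matrix n n ℂ := fun t => (1 + t * p) • X + (1 + t * q) • Y
  let Δ : Matrix n n ℂ := p • X + q • Y
  have hv : ∀ t : ℝ, 0 ≤ t → t ≤ 1 → m ≤ 1 + t * p := fun t => le_one_add_mul hm₁ hmp
  have hu : ∀ t : ℝ, 0 ≤ t → t ≤ 1 → m ≤ 1 + t * q := fun t => le_one_add_mul hm₁ hmq
  have hω : ∀ t : ℝ, 0 ≤ t → t ≤ 1 → (ω t).PosSemidef := fun t ht₀ ht₁ =>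
    (hX.smul (hm₀.le.trans (hv t ht₀ ht₁))).add (hY.smul (hm₀.le.trans (hu t ht₀ ht₁)))
  have hker : ∀ t s : ℝ, 0 ≤ t → t ≤ 1 → 0 ≤ s → s ≤ 1 → ∀ z : n → ℂ,
      ω t *ᵥ z = 0 ↔ ω s *ᵥ z = 0 := fun t s ht₀ ht₁ hs₀ hs₁ z =>
    (mulVec_smul_add_smul_eq_zero_iff hX hY (hm₀.trans_le (hv t ht₀ ht₁))
      (hm₀.trans_le (hu t ht₀ ht₁)) z).trans
      (mulVec_smul_add_smul_eq_zero_iff hX hY (hm₀.trans_le (hv s hs₀ hs₁))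
        (hm₀.trans_le (hu s hs₀ hs₁)) z).symm
  have hsub : ∀ t s : ℝ, ω s - ω t = (s - t) • Δ := fun t s => by
    simp only [ω, Δ]
    module
  have htr : ∀ t s : ℝ, (ω t).trace = (ω s).trace := fun t s => by
    rw [← sub_eq_zero, ← Matrix.trace_sub, hsub, Matrix.trace_smul, Matrix.trace_add,
      Matrix.trace_smul, Matrix.trace_smul, hx, hy]
    have : p • (x : ℂ) + q • (y : ℂ) = ((p * x + q * y : ℝ) : ℂ) := by
      push_cast
      simp
    rw [this, hxy, Complex.ofReal_zero, smul_zero]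
  -- First integration: `Tr[Δ log ω]` grows no faster than its commuting counterpart, up to a
  -- quadratic error.
  have hφ : ∀ t s : ℝ, 0 ≤ t → t ≤ s → s ≤ 1 →
      ((Δ * cfc Real.log (ω s)).trace.re - (x * (p * Real.log (1 + s * p))
          + y * (q * Real.log (1 + s * q))))
        - ((Δ * cfc Real.log (ω t)).trace.re - (x * (p * Real.log (1 + t * p))
          + y * (q * Real.log (1 + t * q))))
      ≤ (x * (|p| ^ 3 / m ^ 2 / 2) + y * (|q| ^ 3 / m ^ 2 / 2)) * (s - t) ^ 2 := by
    intro t s ht hts hs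
    rcases hts.eq_or_lt with rfl | hts'
    · simp
    have hs₀ := ht.trans hts
    have ht₁ := hts.trans hs
    have h₁ := two_mul_trace_sub_mul_log_sub_log_le (hω s hs₀ hs) (hω t ht ht₁)
      (hker s t hs₀ hs ht ht₁)
    have h₂ := trace_inv_mul_sq_le hX hY (hm₀.trans_le (hv s hs₀ hs))
      (hm₀.trans_le (hu s hs₀ hs)) p q
    have h₃ := trace_inv_mul_sq_le hX hY (hm₀.trans_le (hv t ht ht₁))
      (hm₀.trans_le (hu t ht ht₁)) p q
    rw [hsub] at h₁
    simp only [smul_mul_assoc, mul_smul_comm, Matrix.trace_smul, Complex.smul_re, smul_eq_mul,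
      mul_sub, Matrix.trace_sub, Complex.sub_re] at h₁
    change (cfc (fun x : ℝ => x⁻¹) (ω s) * (Δ * Δ)).trace.re ≤ _ at h₂
    change (cfc (fun x : ℝ => x⁻¹) (ω t) * (Δ * Δ)).trace.re ≤ _ at h₃
    simp only [hx, hy, Complex.ofReal_re] at h₂ h₃
    have h₄ : (Δ * cfc Real.log (ω s)).trace.re - (Δ * cfc Real.log (ω t)).trace.re
        ≤ (s - t) / 2 * ((cfc (fun x : ℝ => x⁻¹) (ω s) * (Δ * Δ)).trace.re
          + (cfc (fun x : ℝ => x⁻¹) (ω t) * (Δ * Δ)).trace.re) := by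
      refine le_of_mul_le_mul_left ?_ (sub_pos.mpr hts')
      linarith
    have h₅ := mul_le_mul_of_nonneg_left (add_le_add h₂ h₃)
      (div_nonneg (sub_nonneg.mpr hts) zero_le_two)
    have h₆ := mul_le_mul_of_nonneg_left
      (mul_trapezoid_sub_log_le hm₀ (hv t ht ht₁) (hv s hs₀ hs)) hx₀
    have h₇ := mul_le_mul_of_nonneg_left
      (mul_trapezoid_sub_log_le hm₀ (hu t ht ht₁) (hu s hs₀ hs)) hy₀
    linarith
  have hΦ : ∀ s : ℝ, 0 ≤ s → s ≤ 1 →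
      (Δ * cfc Real.log (ω s)).trace.re - (Δ * cfc Real.log (ω 0)).trace.re
        ≤ x * (p * Real.log (1 + s * p)) + y * (q * Real.log (1 + s * q)) := by
    intro s hs₀ hs₁
    have := le_of_sub_le_const_mul_sq
      (g := fun s => (Δ * cfc Real.log (ω s)).trace.re - (x * (p * Real.log (1 + s * p))
        + y * (q * Real.log (1 + s * q)))) hφ le_rfl hs₀ hs₁
    simp only [zero_mul, add_zero, Real.log_one, mul_zero] at this
    linarith
  -- Second integration: the same comparison for the relative entropy to `ω 0`, with slope
  -- controlled by `hΦ`.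
  have hD : ∀ t s : ℝ, 0 ≤ t → t ≤ s → s ≤ 1 →
      ((ω s * cfc Real.log (ω s)).trace.re - (ω s * cfc Real.log (ω 0)).trace.re
          - (x * ((1 + s * p) * Real.log (1 + s * p)) + y * ((1 + s * q) * Real.log (1 + s * q))))
        - ((ω t * cfc Real.log (ω t)).trace.re - (ω t * cfc Real.log (ω 0)).trace.re
          - (x * ((1 + t * p) * Real.log (1 + t * p)) + y * ((1 + t * q) * Real.log (1 + t * q))))
      ≤ (x * (p ^ 2 / m) + y * (q ^ 2 / m)) * (s - t) ^ 2 := by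
    intro t s ht hts hs
    have hs₀ := ht.trans hts
    have ht₁ := hts.trans hs
    have h₁ := trace_mul_log_sub_le (hω s hs₀ hs) (hω t ht ht₁) (hker s t hs₀ hs ht ht₁) (htr s t)
    have h₂ : (ω s * cfc Real.log (ω 0)).trace.re - (ω t * cfc Real.log (ω 0)).trace.re
        = (s - t) * (Δ * cfc Real.log (ω 0)).trace.re := by
      rw [← Complex.sub_re, ← Matrix.trace_sub, ← sub_mul, hsub, smul_mul_assoc,
        Matrix.trace_smul, Complex.smul_re, smul_eq_mul]
    rw [hsub, smul_mul_assoc, Matrix.trace_smul, Complex.smul_re, smul_eq_mul] at h₁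
    have h₃ := mul_le_mul_of_nonneg_left (hΦ s hs₀ hs) (sub_nonneg.mpr hts)
    have h₄ := mul_le_mul_of_nonneg_left
      (mul_log_sub_mul_log_le hm₀ (hv t ht ht₁) (hv s hs₀ hs)) hx₀
    have h₅ := mul_le_mul_of_nonneg_left
      (mul_log_sub_mul_log_le hm₀ (hu t ht ht₁) (hu s hs₀ hs)) hy₀
    have h₆ : (s - t) * (p * x + q * y) = 0 := by rw [hxy, mul_zero]
    linarith
  have hfin := le_of_sub_le_const_mul_sq (g := fun s =>
    (ω s * cfc Real.log (ω s)).trace.re - (ω s * cfc Real.log (ω 0)).trace.re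
      - (x * ((1 + s * p) * Real.log (1 + s * p)) + y * ((1 + s * q) * Real.log (1 + s * q))))
    hD le_rfl zero_le_one le_rfl
  have hω₀ : ω 0 = X + Y := by simp [ω]
  have hω₁ : ω 1 = (1 + p) • X + (1 + q) • Y := by simp [ω]
  simp only [zero_mul, add_zero, Real.log_one, mul_zero, one_mul, hω₀, hω₁] at hfin
  rw [mul_sub, Matrix.trace_sub, Complex.sub_re]
  linarith

end Segment

/-! ### Relative entropy of private pairs -/

section RelativeEntropy

variable {n : Type*} [Fintype n] [DecidableEq n] {ρ σ : Matrix n n ℂ} {ε : ℝ}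

open scoped MatrixOrder Matrix.Norms.L2Operator in
theorem exists_pos_isTest_smul {Λ : Matrix n n ℂ} (h : Λ.PosSemidef) :
    ∃ r : ℝ, 0 < r ∧ IsTest (r • Λ) := by
  have hle : Λ ≤ algebraMap ℝ (Matrix n n ℂ) ‖Λ‖ := IsSelfAdjoint.le_algebraMap_norm_self h.1
  have hc : 0 < ‖Λ‖ + 1 := by positivity
  refine ⟨(‖Λ‖ + 1)⁻¹, inv_pos.mpr hc, h.smul (inv_nonneg.mpr hc.le), ?_⟩
  have e : 1 - (‖Λ‖ + 1)⁻¹ • Λ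
      = (‖Λ‖ + 1)⁻¹ • ((algebraMap ℝ (Matrix n n ℂ) ‖Λ‖ - Λ) + 1) := by
    rw [Algebra.algebraMap_eq_smul_one, smul_add, smul_sub, smul_smul, sub_add_eq_add_sub,
      ← add_smul, inv_mul_eq_div, ← one_div, ← add_div, div_self hc.ne', one_smul]
  rw [e]
  exact ((Matrix.le_iff.mp hle).add Matrix.PosSemidef.one).smul (inv_nonneg.mpr hc.le)

/-- For `δ = 0` privacy is homogeneous in the test, so suitably scaled rank-one tests already give
the operator inequality. -/
theorem IsDP.exp_smul_sub_posSemidef (h : IsDP ε 0 ρ σ) :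
    (Real.exp ε • σ - ρ).PosSemidef := by
  have hH : (Real.exp ε • σ - ρ).IsHermitian := by
    rw [Matrix.IsHermitian, Matrix.conjTranspose_sub, Matrix.conjTranspose_smul,
      h.left_density.posSemidef.1.eq, h.right_density.posSemidef.1.eq, star_trivial]
  refine Matrix.PosSemidef.of_dotProduct_mulVec_nonneg hH fun z => ?_
  have him : (star z ⬝ᵥ (Real.exp ε • σ - ρ) *ᵥ z).im = 0 := hH.im_star_dotProduct_mulVec_self z
  obtain ⟨r, hr, hΛ⟩ := exists_pos_isTest_smul (Matrix.posSemidef_vecMulVec_self_star z)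
  have hz : ∀ A : Matrix n n ℂ,
      (r • Matrix.vecMulVec z (star z) * A).trace.re = r * (star z ⬝ᵥ A *ᵥ z).re := by
    intro A
    rw [smul_mul_assoc, Matrix.trace_smul, Complex.smul_re, smul_eq_mul, Matrix.vecMulVec_mul,
      Matrix.trace_vecMulVec, Matrix.dotProduct_mulVec, dotProduct_comm]
  have hle := h.left_le _ hΛ
  rw [hz, hz, add_zero, mul_left_comm] at hle
  have hre : 0 ≤ (star z ⬝ᵥ (Real.exp ε • σ - ρ) *ᵥ z).re := by
    rw [Matrix.sub_mulVec, dotProduct_sub, Matrix.smul_mulVec, dotProduct_smul, Complex.sub_re,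
      Complex.smul_re, smul_eq_mul, sub_nonneg]
    exact le_of_mul_le_mul_left hle hr
  exact Complex.le_def.mpr ⟨hre, him.symm⟩

theorem IsDP.mulVec_eq_zero (h : IsDP ε 0 ρ σ) {z : n → ℂ} (hz : σ *ᵥ z = 0) : ρ *ᵥ z = 0 := by
  have h₁ := h.exp_smul_sub_posSemidef.dotProduct_mulVec_nonneg z
  rw [Matrix.sub_mulVec, Matrix.smul_mulVec, hz, smul_zero, zero_sub, dotProduct_neg] at h₁
  exact (h.left_density.posSemidef.dotProduct_mulVec_zero_iff z).mp
    (le_antisymm (neg_nonneg.mp h₁) (h.left_density.posSemidef.dotProduct_mulVec_nonneg z))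

theorem trace_mul_log_sub_log_le_of_isDP (hε : 0 ≤ ε) (h : IsDP ε 0 ρ σ) :
    (ρ * (cfc Real.log ρ - cfc Real.log σ)).trace.re
      ≤ ε * ((Real.exp ε - 1) / (1 + Real.exp ε)) := by
  -- The decomposition below divides by `b ^ 2 - 1`. At `ε = 0` the states coincide, their
  -- difference being positive semidefinite with trace zero.
  rcases hε.eq_or_lt with rfl | hε
  · have hρσ : ρ = σ := by
      have h₁ := h.exp_smul_sub_posSemidef
      have h₂ := h.symm.exp_smul_sub_posSemidef
      rw [Real.exp_zero, one_smul] at h₁ h₂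
      rw [← neg_sub] at h₂
      have htr : (σ - ρ).trace = 0 := by
        rw [Matrix.trace_sub, h.left_density.trace_eq_one, h.right_density.trace_eq_one, sub_self]
      exact (sub_eq_zero.mp (h₁.trace_eq_zero_iff.mp htr)).symm
    simp [hρσ]
  have hb : 1 < Real.exp ε := Real.one_lt_exp_iff.mpr hε
  have hlog : Real.log (Real.exp ε) = ε := Real.log_exp ε
  have h₁ := h.exp_smul_sub_posSemidef
  have h₂ := h.symm.exp_smul_sub_posSemidef
  generalize Real.exp ε = b at *
  have hb₀ : 0 < b := by linarith
  have hd : 0 < b ^ 2 - 1 := by nlinarith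
  -- These are the solutions of `X + Y = σ`, `b⁻¹ X + b Y = ρ`; their traces are the model weights
  -- of `σ` where the ratio is `b⁻¹` and `b`.
  have hX := h₁.smul (div_nonneg hb₀.le hd.le)
  have hY := h₂.smul (inv_nonneg.mpr hd.le)
  have hx : ((b / (b ^ 2 - 1)) • (b • σ - ρ)).trace = ((b / (1 + b) : ℝ) : ℂ) := by
    have e : b / (1 + b) = b / (b ^ 2 - 1) * (b - 1) := by
      have : 1 + b ≠ 0 := by linarith
      field_simp
      ring
    rw [Matrix.trace_smul, Matrix.trace_sub, Matrix.trace_smul, h.left_density.trace_eq_one,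
      h.right_density.trace_eq_one, e]
    push_cast
    simp
  have hy : ((b ^ 2 - 1)⁻¹ • (b • ρ - σ)).trace = ((1 / (1 + b) : ℝ) : ℂ) := by
    have e : 1 / (1 + b) = (b ^ 2 - 1)⁻¹ * (b - 1) := by
      have : 1 + b ≠ 0 := by linarith
      field_simp
      ring
    rw [Matrix.trace_smul, Matrix.trace_sub, Matrix.trace_smul, h.left_density.trace_eq_one,
      h.right_density.trace_eq_one, e]
    push_cast
    simp
  have key := trace_mul_log_sub_log_le hX hY (p := b⁻¹ - 1) (q := b - 1) (by simpa using hb₀)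
    (by simpa using hb₀) hx hy (by field_simp; ring)
  rw [add_sub_cancel, add_sub_cancel] at key
  have eσ : (b / (b ^ 2 - 1)) • (b • σ - ρ) + (b ^ 2 - 1)⁻¹ • (b • ρ - σ) = σ := by
    match_scalars <;> field_simp <;> ring
  have eρ : b⁻¹ • (b / (b ^ 2 - 1)) • (b • σ - ρ) + b • (b ^ 2 - 1)⁻¹ • (b • ρ - σ) = ρ := by
    match_scalars <;> field_simp <;> ring
  rw [eσ, eρ, Real.log_inv, hlog] at key
  refine key.trans (le_of_eq ?_)
  field_simp
  ring

theorem relativeEntropy_weakest_of_pos {δ : ℝ} (hδ : 0 < δ) :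
    relativeEntropy (weakestRho ε δ) (weakestSigma ε δ) = ⊤ := by
  refine if_neg fun h => ?_
  -- `|00⟩` lies in the kernel of the model `σ` but not in that of the model `ρ`.
  have h₁ := h (Pi.single 0 1) (by
    ext i
    simp [weakestSigma])
  have h₂ := congrFun h₁ 0
  simp [weakestRho] at h₂
  exact hδ.ne' h₂

theorem le_relativeEntropy_weakest (ε : ℝ) :
    ((ε * ((Real.exp ε - 1) / (1 + Real.exp ε)) : ℝ) : EReal)
      ≤ relativeEntropy (weakestRho ε 0) (weakestSigma ε 0) := by
  unfold relativeEntropy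
  -- The support condition need not be decided: its failure would give the value `⊤`.
  split_ifs
  · refine EReal.coe_le_coe_iff.mpr (le_of_eq ?_)
    rw [weakestRho, weakestSigma, cfc_diagonal, cfc_diagonal, mul_sub, Matrix.trace_sub,
      Complex.sub_re, trace_diagonal_mul_diagonal_re, trace_diagonal_mul_diagonal_re,
      Fin.sum_univ_four, Fin.sum_univ_four]
    have hb := Real.exp_pos ε
    have hb' : 1 + Real.exp ε ≠ 0 := by positivity
    have h₁ : Real.log (Real.exp ε / (1 + Real.exp ε)) = ε - Real.log (1 + Real.exp ε) := by
      rw [Real.log_div hb.ne' hb', Real.log_exp]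
    have h₂ : Real.log (1 / (1 + Real.exp ε)) = - Real.log (1 + Real.exp ε) := by
      rw [one_div, Real.log_inv]
    simp only [Matrix.cons_val_zero, Matrix.cons_val_one, Matrix.cons_val, sub_zero, one_mul,
      zero_mul, add_zero, zero_add, h₁, h₂]
    field_simp
    ring
  · exact le_top

theorem relativeEntropy_le_weakest {δ : ℝ} (hε : 0 ≤ ε) (hδ₀ : 0 ≤ δ) (h : IsDP ε δ ρ σ) :
    relativeEntropy ρ σ ≤ relativeEntropy (weakestRho ε δ) (weakestSigma ε δ) := by
  rcases hδ₀.eq_or_lt with rfl | hδ₀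
  · refine le_trans ?_ (le_relativeEntropy_weakest ε)
    rw [relativeEntropy, if_pos fun z hz => h.mulVec_eq_zero hz]
    exact EReal.coe_le_coe_iff.mpr (trace_mul_log_sub_log_le_of_isDP hε h)
  · rw [relativeEntropy_weakest_of_pos hδ₀]
    exact le_top

end RelativeEntropy

end QuantumDP

theorem mainTheorem1 {n : Type*} [Fintype n] [DecidableEq n] (ε δ : ℝ) (hε : 0 ≤ ε)
    (hδ₀ : 0 ≤ δ) (hδ₁ : δ ≤ 1) (ρ σ : Matrix n n ℂ) (h : QuantumDP.IsDP ε δ ρ σ) :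
    (∀ f : ℝ → ℝ, QuantumDP.IsFDivFunction f →
      QuantumDP.fDivergence f ρ σ ≤
        QuantumDP.fDivergence f (QuantumDP.weakestRho ε δ) (QuantumDP.weakestSigma ε δ)) ∧
    (∀ γ : ℝ, 0 ≤ γ →
      QuantumDP.hockeyStick γ ρ σ ≤
        QuantumDP.hockeyStick γ (QuantumDP.weakestRho ε δ) (QuantumDP.weakestSigma ε δ)) ∧
    (∀ α : ℝ, 0 ≤ α → α ≠ 1 →
      QuantumDP.hockeyStickRenyi α ρ σ ≤
        QuantumDP.hockeyStickRenyi α (QuantumDP.weakestRho ε δ) (QuantumDP.weakestSigma ε δ)) ∧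
    (QuantumDP.relativeEntropy ρ σ ≤
      QuantumDP.relativeEntropy (QuantumDP.weakestRho ε δ) (QuantumDP.weakestSigma ε δ)) ∧
    (∀ α : ℝ, 0 ≤ α → α ≠ 1 →
      QuantumDP.measuredRenyi α ρ σ ≤
        QuantumDP.measuredRenyi α (QuantumDP.weakestRho ε δ) (QuantumDP.weakestSigma ε δ)) := by
  exact ⟨fun f hf => QuantumDP.fDivergence_le_weakest hε hδ₀ hδ₁ h hf,
    fun γ hγ => QuantumDP.hockeyStick_le_weakest hε hδ₀ hδ₁ h hγ,
    fun α _ _ => QuantumDP.hockeyStickRenyi_le_weakest hε hδ₀ hδ₁ h α,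
    QuantumDP.relativeEntropy_le_weakest hε hδ₀ h,
    fun α hα₀ hα₁ => QuantumDP.measuredRenyi_le_weakest hε hδ₀ hδ₁ h hα₀ hα₁⟩
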